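/- All graphs are finite and simple. A graph $G$ is a *path graph* if there are a tree $T$ and a bijection $\phi$ from $V(G)$ onto a collection of paths of $T$ (one-vertex paths allowed) such that two distinct vertices $u,v$ of $G$ are adjacent if and only if the vertex sets of $\phi(u)$ and $\phi(v)$ intersect. $G$ is *chordal* if it has no induced cycle of length at least four. "Clique" means inclusion-wise maximal clique. A *clique separator* of $G$ is a clique $Q$ such that $G-Q$ has at least two connected components. Let $V_1,\dots,V_s$ be the vertex sets of these components, $\gamma_i=G[V_i\cup Q]$ and $\Gamma_Q=\{\gamma_1,\dots,\gamma_s\}$. A *relevant clique* of $\gamma\in\Gamma_Q$ is a clique $K$ of the graph $\gamma$ with $K\cap Q\neq\emptyset$ and $K\neq Q$; $\gamma$ is a *neighboring subgraph* of a vertex $v$ if $v$ lies in some relevant clique of $\gamma$. For $\gamma,\gamma'\in\Gamma_Q$: - $\gamma\Join\gamma'$ (*attached*) if $K\cap K'\cap Q\neq\emptyset$ for some relevant cliques $K$ of $\gamma$ and $K'$ of $\gamma'$; - $\gamma\le\gamma'$ (*dominance*) if $\gamma=\gamma'$, or $\gamma\Join\gamma'$ and for each relevant clique $K'$ of $\gamma'$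 either $K\cap Q\subseteq K'\cap Q$ for every relevant clique $K$ of $\gamma$, or $K\cap K'\cap Q=\emptyset$ for every relevant clique $K$ of $\gamma$; - $\gamma\leftrightarrow\gamma'$ (*antipodal*) if $\gamma\Join\gamma'$, $\gamma\not\le\gamma'$ and $\gamma'\not\le\gamma$. Dominance is a preorder. From now on $\Gamma_Q$ stands for its quotient in which $\gamma$ and $\gamma'$ are identified if $\gamma\le\gamma'$ and $\gamma'\le\gamma$; it is partially ordered by $\le$, and a class is attached to another class, or is a neighboring subgraph of $v$, if this holds for some representatives; two classes are antipodal if they are attached and $\le$-incomparable. A *full antipodal triple* consists of three pairwise antipodal elements of $\Gamma_Q$ that are neighboring subgraphs of a common vertex $v\in Q$. Let $\mathrm{Upper}_Q$ be the set of $u\in\Gamma_Q$ with $u\not\le\gamma$ for all $\gamma\neq u$, let $\ell=|\mathrm{Upper}_Q|$, and fix for each $Q$ an arbitrary ordering $(u_1,\dots,u_\ell)$ of $\mathrm{Upper}_Q$. For $i<j$ in $[\ell]=\{1,\dots,\ell\}$ let $$D_i=\{\gamma\in\Gamma_Q : \gamma\le u_i,\ \gamma\not\le u_k\ \forall k\ne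 i\},\qquad D_{i,j}=\{\gamma\in\Gamma_Q : \gamma\le u_i,\ \gamma\le u_j,\ \gamma\not\le u_k\ \forall k\ne i,j\},$$ and let the *$Q$-skeleton* be $\mathcal D=\{D_i : i\in[\ell]\}\cup\{D_{i,j} : i<j\in[\ell]\}$. **Theorem.** A chordal graph $G$ is a path graph if and only if, for every clique separator $Q$ of $G$, $\mathrm{Upper}_Q$ contains no full antipodal triple and $G$ is weak $Q$-colorable, that is, there exists $f:\Gamma_Q\to[\ell+1]$ such that: - (a) for all $i\in[\ell]$, $f(u_i)=i$; - (b) for all $i\in[\ell]$ and $\gamma\in D_i$, $f(\gamma)\in\{i,\ell+1\}$; - (c) for all $i<j\in[\ell]$ and $\gamma\in D_{i,j}$, $f(\gamma)\in\{i,j\}$; - (d) for all $i\in[\ell]$ and $\gamma\in D_i$, if $\gamma\leftrightarrow u$ for some $u\in\mathrm{Upper}_Q$, then $f(\gamma)=i$; - (e) for all $i<j\in[\ell]$, $k\in\{i,j\}$ and $\gamma\in D_{i,j}$, if $\gamma\leftrightarrow\gamma'$ for some $\gamma'\in D_k$, then $f(\gamma)$ is the element of $\{i,j\}\setminus\{k\}$;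 - (f) for all $D\in\mathcal D$ and $\gamma,\gamma'\in D$ with $\gamma\leftrightarrow\gamma'$, $f(\gamma)\ne f(\gamma')$. -/

import Mathlib

universe u

namespace PathGraph

variable {V : Type u}

/-- `s` is the vertex set of a path of the graph `T` (one-vertex paths are allowed). -/
def IsPathVertexSet {W : Type u} (T : SimpleGraph W) (s : Set W) : Prop :=
  ∃ (a b : W) (p : T.Walk a b), p.IsPath ∧ s = {w | w ∈ p.support}

/-- `G` is a path graph: there are a finite host tree `T` and a bijection from the vertices of `G`
onto a collection of paths of `T` such that two distinct vertices are adjacent if and only if the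
vertex sets of their paths intersect. A path of a tree is identified with its vertex set. -/
def IsPathGraph (G : SimpleGraph V) : Prop :=
  ∃ (W : Type u) (_ : Finite W) (T : SimpleGraph W) (φ : V → Set W),
    T.IsTree ∧ (∀ v, IsPathVertexSet T (φ v)) ∧ Function.Injective φ ∧
      ∀ v w, v ≠ w → (G.Adj v w ↔ (φ v ∩ φ w).Nonempty)

/-- `G` is chordal: it has no induced cycle of length at least four. -/
def IsChordal (G : SimpleGraph V) : Prop :=
  ∀ n : ℕ, 4 ≤ n → ¬ (SimpleGraph.cycleGraph n).IsIndContained G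

/-- A clique separator: a maximal clique whose removal leaves more than one connected component. -/
def IsCliqueSeparator (G : SimpleGraph V) (Q : Set V) : Prop :=
  Maximal G.IsClique Q ∧ Nontrivial (G.ComponentCompl Q)

/-- The members of `Γ_Q`: there is one for every connected component of `G - Q`, namely the
subgraph induced by the component together with `Q`. (This is a separate type because
`G.ComponentCompl Q` already carries the inclusion order.) -/
@[ext]
structure SepPart (G : SimpleGraph V) (Q : Set V) where
  comp : G.ComponentCompl Q

variable {G : SimpleGraph V} {Q : Set V}

/-- The vertex set `V_i ∪ Q` of `γ_i = G[V_i ∪ Q]`. -/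
def SepPart.verts (γ : SepPart G Q) : Set V := γ.comp.supp ∪ Q

/-- `K` is a relevant clique of `γ`: a maximal clique of `γ` with `K ∩ Q ≠ ∅` and `K ≠ Q`. -/
def SepPart.Relevant (γ : SepPart G Q) (K : Set V) : Prop :=
  Maximal (fun S : Set V => S ⊆ γ.verts ∧ G.IsClique S) K ∧ (K ∩ Q).Nonempty ∧ K ≠ Q

/-- `γ` is a neighboring subgraph of the vertex `v`. -/
def SepPart.NeighborOf (γ : SepPart G Q) (v : V) : Prop :=
  ∃ K, γ.Relevant K ∧ v ∈ K

/-- Attachedness. -/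
def SepPart.Attached (γ γ' : SepPart G Q) : Prop :=
  ∃ K K', γ.Relevant K ∧ γ'.Relevant K' ∧ (K ∩ K' ∩ Q).Nonempty

/-- The defining condition of dominance of `γ` by a different member `γ'`. -/
def SepPart.DominatedBy (γ γ' : SepPart G Q) : Prop :=
  γ.Attached γ' ∧ ∀ K', γ'.Relevant K' →
    (∀ K, γ.Relevant K → K ∩ Q ⊆ K' ∩ Q) ∨ (∀ K, γ.Relevant K → K ∩ K' ∩ Q = ∅)

/-- Dominance, a preorder on `Γ_Q`; it is reflexive by convention. -/
instance : Preorder (SepPart G Q) where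
  le γ γ' := γ = γ' ∨ γ.DominatedBy γ'
  le_refl _ := Or.inl rfl
  le_trans := by
    rintro a b c (rfl | hab) (rfl | hbc)
    · exact Or.inl rfl
    · exact Or.inr hbc
    · exact Or.inr hab
    · right
      obtain ⟨⟨A, B, hA, hB, v, hv⟩, hab'⟩ := hab
      obtain ⟨⟨B', C, hB', hC, w, hw⟩, hbc'⟩ := hbc
      have hAB : ∀ K, a.Relevant K → K ∩ Q ⊆ B ∩ Q := by
        rcases hab' B hB with h | h
        · exact h
        · exact absurd ⟨v, hv⟩ (Set.not_nonempty_iff_eq_empty.mpr (h A hA))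
      have hBC : ∀ K, b.Relevant K → K ∩ Q ⊆ C ∩ Q := by
        rcases hbc' C hC with h | h
        · exact h
        · exact absurd ⟨w, hw⟩ (Set.not_nonempty_iff_eq_empty.mpr (h B' hB'))
      refine ⟨⟨A, C, hA, hC, v, ⟨hv.1.1, (hBC B hB ⟨hv.1.2, hv.2⟩).1⟩, hv.2⟩, fun K' hK' => ?_⟩
      rcases hbc' K' hK' with h | h
      · exact Or.inl fun K hK => (hAB K hK).trans (h B hB)
      · refine Or.inr fun K hK => Set.eq_empty_iff_forall_notMem.mpr fun x hx => ?_
        have hxB := (hAB K hK ⟨hx.1.1, hx.2⟩).1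
        exact (Set.eq_empty_iff_forall_notMem.mp (h B hB)) x ⟨⟨hxB, hx.1.2⟩, hx.2⟩

/-- `Γ_Q` with mutually dominating members identified, partially ordered by dominance. -/
abbrev Gam (G : SimpleGraph V) (Q : Set V) : Type u :=
  Antisymmetrization (SepPart G Q) (· ≤ ·)

/-- The class in `Gam G Q` of a member of `Γ_Q`. -/
abbrev SepPart.cls (γ : SepPart G Q) : Gam G Q := toAntisymmetrization (· ≤ ·) γ

/-- A class is a neighboring subgraph of `v` if one of its representatives is. -/
def Gam.NeighborOf (c : Gam G Q) (v : V) : Prop :=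
  ∃ γ : SepPart G Q, γ.cls = c ∧ γ.NeighborOf v

/-- Attachedness of classes. -/
def Gam.Attached (c c' : Gam G Q) : Prop :=
  ∃ γ γ' : SepPart G Q, γ.cls = c ∧ γ'.cls = c' ∧ γ.Attached γ'

/-- Antipodality: attached, and neither one dominates the other. -/
def Gam.Antipodal (c c' : Gam G Q) : Prop :=
  c.Attached c' ∧ ¬ c ≤ c' ∧ ¬ c' ≤ c

/-- `Upper_Q`: the elements that are dominated by no other element. -/
def Upper (G : SimpleGraph V) (Q : Set V) : Set (Gam G Q) :=
  {u | ∀ c, c ≠ u → ¬ u ≤ c}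

/-- A full antipodal triple: three pairwise antipodal elements which are neighboring subgraphs of
a common vertex of `Q`. -/
def IsFullAntipodalTriple (a b c : Gam G Q) : Prop :=
  a.Antipodal b ∧ a.Antipodal c ∧ b.Antipodal c ∧
    ∃ v ∈ Q, a.NeighborOf v ∧ b.NeighborOf v ∧ c.NeighborOf v

/-- The number `ℓ = |Upper_Q|`. -/
noncomputable def ell (G : SimpleGraph V) (Q : Set V) : ℕ := Nat.card (Upper G Q)

/-- An ordering `(u_1, ..., u_ℓ)` of `Upper_Q`. -/
abbrev UpperOrdering (G : SimpleGraph V) (Q : Set V) : Type u := Fin (ell G Q) ≃ Upper G Q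

/-- `D_i`: the elements dominated by `u_i` and by no other element of `Upper_Q`. -/
def D₁ (o : UpperOrdering G Q) (i : Fin (ell G Q)) : Set (Gam G Q) :=
  {c | c ≤ (o i : Gam G Q) ∧ ∀ k, k ≠ i → ¬ c ≤ (o k : Gam G Q)}

/-- `D_{i,j}`: the elements dominated by `u_i` and `u_j` and by no other element of `Upper_Q`. -/
def D₂ (o : UpperOrdering G Q) (i j : Fin (ell G Q)) : Set (Gam G Q) :=
  {c | c ≤ (o i : Gam G Q) ∧ c ≤ (o j : Gam G Q) ∧
    ∀ k, k ≠ i → k ≠ j → ¬ c ≤ (o k : Gam G Q)}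

/-- The `Q`-skeleton. -/
def skeleton (o : UpperOrdering G Q) : Set (Set (Gam G Q)) :=
  {D | (∃ i, D = D₁ o i) ∨ ∃ i j, i < j ∧ D = D₂ o i j}

/-- `f` is a weak `Q`-coloring. The color set `[ℓ+1]` is `Fin (ℓ+1)`: the color `i ∈ [ℓ]` is
`i.castSucc`, and the color `ℓ+1` is `Fin.last ℓ`. -/
structure IsWeakColoring (o : UpperOrdering G Q) (f : Gam G Q → Fin (ell G Q + 1)) : Prop where
  upper : ∀ i, f (o i : Gam G Q) = i.castSucc
  single : ∀ i, ∀ c ∈ D₁ o i, f c = i.castSucc ∨ f c = Fin.last (ell G Q)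
  double : ∀ i j, i < j → ∀ c ∈ D₂ o i j, f c = i.castSucc ∨ f c = j.castSucc
  single_antipodal : ∀ i, ∀ c ∈ D₁ o i, (∃ u ∈ Upper G Q, c.Antipodal u) → f c = i.castSucc
  double_antipodal : ∀ i j, i < j → ∀ c ∈ D₂ o i j,
    ((∃ c' ∈ D₁ o i, c.Antipodal c') → f c = j.castSucc) ∧
    ((∃ c' ∈ D₁ o j, c.Antipodal c') → f c = i.castSucc)
  proper : ∀ D ∈ skeleton o, ∀ c ∈ D, ∀ c' ∈ D, c.Antipodal c' → f c ≠ f c'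

end PathGraph

/-!
Call a coloring of `Γ_Q` strong if antipodal classes get different colors and the neighboring
subgraphs of every vertex of `Q` get at most two colors. Both sides of the theorem are compared with
the existence of strong colorings.

Weak and strong colorings differ only by combinatorics of the dominance order: a strong coloring
excludes full antipodal triples and becomes weak when every class without the color of an upper
element above it is sent to the extra color; conversely, if no three upper elements form a full
antipodal triple, then at most two of them are neighboring subgraphs of a given vertex, and a weak
coloring is already strong.

Given a path representation, root the host tree at a node common to the paths of the vertices of
`Q` and color each part by the neighbor of the root towards its paths. Two attached parts in the
same branch are comparable, and a path through the root meets at most two branches.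

Given strong colorings at all maximal cliques, build a clique path tree by induction on the
component of a part: chordality provides a maximal clique that meets the component and contains all
the vertices of `Q` attached to it. The trees of the parts of that clique are hung one after the
other, dominating parts first, each at the common end of the paths of its color. Pendant nodes
finally make the paths of different vertices different.
-/

namespace PathGraph

open SimpleGraph

section Coloring

variable {V : Type u} {G : SimpleGraph V} {Q : Set V}

namespace SepPart

variable {γ γ' : SepPart G Q} {v : V}

theorem attached_iff : γ.Attached γ' ↔ ∃ v ∈ Q, γ.NeighborOf v ∧ γ'.NeighborOf v := by
  constructor
  · rintro ⟨K, K', hK, hK', v, ⟨hv, hv'⟩, hvQ⟩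
    exact ⟨v, hvQ, ⟨K, hK, hv⟩, K', hK', hv'⟩
  · rintro ⟨v, hvQ, ⟨K, hK, hv⟩, K', hK', hv'⟩
    exact ⟨K, K', hK, hK', v, ⟨hv, hv'⟩, hvQ⟩

theorem NeighborOf.mono (hγ : γ.NeighborOf v) (hle : γ ≤ γ') (hv : v ∈ Q) :
    γ'.NeighborOf v := by
  obtain rfl | ⟨⟨K, K', hK, hK', hKK'⟩, hdom⟩ := hle
  · exact hγ
  · obtain ⟨L, hL, hvL⟩ := hγ
    obtain hsub | hdisj := hdom K' hK'
    · exact ⟨K', hK', (hsub L hL ⟨hvL, hv⟩).1⟩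
    · exact absurd (hdisj K hK) hKK'.ne_empty

theorem cls_le_cls : γ.cls ≤ γ'.cls ↔ γ ≤ γ' :=
  toAntisymmetrization_le_toAntisymmetrization_iff

theorem neighborOf_cls (hv : v ∈ Q) : γ.cls.NeighborOf v ↔ γ.NeighborOf v :=
  ⟨fun ⟨_, hcls, h⟩ => h.mono (cls_le_cls.mp hcls.le) hv, fun h => ⟨γ, rfl, h⟩⟩

end SepPart

namespace Gam

variable {c c' u : Gam G Q} {v : V}

theorem attached_iff : c.Attached c' ↔ ∃ v ∈ Q, c.NeighborOf v ∧ c'.NeighborOf v := by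
  constructor
  · rintro ⟨γ, γ', rfl, rfl, h⟩
    obtain ⟨v, hv, hγ, hγ'⟩ := SepPart.attached_iff.mp h
    exact ⟨v, hv, ⟨γ, rfl, hγ⟩, γ', rfl, hγ'⟩
  · rintro ⟨v, hv, ⟨γ, rfl, hγ⟩, γ', rfl, hγ'⟩
    exact ⟨γ, γ', rfl, rfl, SepPart.attached_iff.mpr ⟨v, hv, hγ, hγ'⟩⟩

theorem NeighborOf.mono (hc : c.NeighborOf v) (hle : c ≤ c') (hv : v ∈ Q) :
    c'.NeighborOf v := by
  induction c' using Antisymmetrization.ind with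
  | _ γ' =>
    obtain ⟨γ, rfl, hγ⟩ := hc
    exact ⟨γ', rfl, hγ.mono (SepPart.cls_le_cls.mp hle) hv⟩

theorem exists_neighborOf_of_lt (h : c < c') : ∃ v ∈ Q, c.NeighborOf v := by
  induction c using Antisymmetrization.ind with
  | _ γ =>
    induction c' using Antisymmetrization.ind with
    | _ γ' =>
      obtain rfl | ⟨hatt, -⟩ := SepPart.cls_le_cls.mp h.le
      · exact absurd h (lt_irrefl _)
      · obtain ⟨v, hv, hγ, -⟩ := SepPart.attached_iff.mp hatt
        exact ⟨v, hv, γ, rfl, hγ⟩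

theorem Antipodal.symm (h : c.Antipodal c') : c'.Antipodal c := by
  obtain ⟨hatt, hle, hge⟩ := h
  obtain ⟨v, hv, hc, hc'⟩ := attached_iff.mp hatt
  exact ⟨attached_iff.mpr ⟨v, hv, hc', hc⟩, hge, hle⟩

theorem mem_upper_iff_isMax : u ∈ Upper G Q ↔ IsMax u := by
  constructor
  · intro hu c huc
    by_contra hcu
    exact hu c (fun h => hcu h.le) huc
  · exact fun hu c hne huc => hne (hu.eq_of_le huc).symm

theorem antipodal_of_isMax (hu : IsMax u) (hcu : ¬ c ≤ u) (hv : v ∈ Q) (hc : c.NeighborOf v)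
    (huv : u.NeighborOf v) : c.Antipodal u :=
  ⟨attached_iff.mpr ⟨v, hv, hc, huv⟩, hcu, fun h => hcu (hu h)⟩

end Gam

instance [Finite V] : Finite (G.ComponentCompl Q) :=
  inferInstanceAs (Finite (Quot _))

instance [Finite V] : Finite (SepPart G Q) :=
  Finite.of_injective SepPart.comp fun _ _ h => SepPart.ext h

instance [Finite V] : Finite (Gam G Q) :=
  inferInstanceAs (Finite (Quotient _))

section UpperOrdering

variable (o : UpperOrdering G Q) {c : Gam G Q} {i j : Fin (ell G Q)} {v : V}

theorem isMax_upper (i : Fin (ell G Q)) : IsMax (o i : Gam G Q) :=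
  Gam.mem_upper_iff_isMax.mp (o i).2

theorem exists_le_upper [Finite V] (c : Gam G Q) : ∃ i, c ≤ (o i : Gam G Q) := by
  obtain ⟨u, hcu, hu⟩ := (Set.toFinite (Set.univ : Set (Gam G Q))).exists_le_maximal
    (Set.mem_univ c)
  have hmax : u ∈ Upper G Q :=
    Gam.mem_upper_iff_isMax.mpr fun d hud => hu.2 (Set.mem_univ d) hud
  exact ⟨o.symm ⟨u, hmax⟩, by simpa using hcu⟩

variable {o}

theorem upper_not_le (hij : i ≠ j) : ¬ (o i : Gam G Q) ≤ o j := fun h =>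
  hij (o.injective (Subtype.ext ((isMax_upper o i).eq_of_le h)))

theorem upper_antipodal (hij : i ≠ j) (hv : v ∈ Q) (hi : (o i : Gam G Q).NeighborOf v)
    (hj : (o j : Gam G Q).NeighborOf v) : (o i : Gam G Q).Antipodal (o j) :=
  Gam.antipodal_of_isMax (isMax_upper o j) (upper_not_le hij) hv hi hj

theorem antipodal_upper_of_mem_D₁ (hc : c ∈ D₁ o i) (hij : i ≠ j) (hv : v ∈ Q)
    (hcv : c.NeighborOf v) (hj : (o j : Gam G Q).NeighborOf v) : c.Antipodal (o j) :=
  Gam.antipodal_of_isMax (isMax_upper o j) (hc.2 j hij.symm) hv hcv hj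

theorem exists_neighborOf_of_le_of_le (hij : i ≠ j) (hi : c ≤ o i) (hj : c ≤ o j) :
    ∃ v ∈ Q, c.NeighborOf v :=
  Gam.exists_neighborOf_of_lt (hi.lt_of_ne fun h => upper_not_le hij (h ▸ hj))

theorem D₂_comm (i j : Fin (ell G Q)) : D₂ o i j = D₂ o j i := by
  ext c
  simp only [D₂, Set.mem_ofPred_eq]
  grind

end UpperOrdering

/-- A strong `Q`-coloring, in the sense of Monma and Wei: antipodal elements have different
colors, and the elements neighboring a given vertex of `Q` have at most two colors. -/
structure IsStrongColoring {α : Type*} (f : Gam G Q → α) : Prop where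
  ne_of_antipodal : ∀ c c', c.Antipodal c' → f c ≠ f c'
  two_colors : ∀ v ∈ Q, ∃ a b, ∀ c, c.NeighborOf v → f c = a ∨ f c = b

open Classical in
/-- The weak coloring made from a strong coloring `f`: the elements with the color of an upper
element above them join that upper element, and all others get the extra color. -/
noncomputable def weakColor {α : Type*} (o : UpperOrdering G Q) (f : Gam G Q → α)
    (c : Gam G Q) : Fin (ell G Q + 1) :=
  if h : ∃ i, c ≤ (o i : Gam G Q) ∧ f c = f (o i) then h.choose.castSucc else Fin.last _

namespace IsStrongColoring

variable {α : Type*} {f : Gam G Q → α} (hf : IsStrongColoring f) {a b c c' u w : Gam G Q}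

include hf

theorem eq_or_eq_or_eq {v : V} (hv : v ∈ Q) (ha : a.NeighborOf v) (hb : b.NeighborOf v)
    (hc : c.NeighborOf v) : f a = f b ∨ f a = f c ∨ f b = f c := by
  obtain ⟨x, y, hxy⟩ := hf.two_colors v hv
  grind

theorem not_isFullAntipodalTriple (a b c : Gam G Q) : ¬ IsFullAntipodalTriple a b c := by
  rintro ⟨hab, hac, hbc, v, hv, ha, hb, hc⟩
  obtain h | h | h := hf.eq_or_eq_or_eq hv ha hb hc
  exacts [hf.ne_of_antipodal _ _ hab h, hf.ne_of_antipodal _ _ hac h,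
    hf.ne_of_antipodal _ _ hbc h]

theorem eq_of_antipodal_isMax (hw : IsMax w) (hcu : c ≤ u) (hcw : c.Antipodal w) :
    f c = f u := by
  obtain ⟨v, hv, hcv, hwv⟩ := Gam.attached_iff.mp hcw.1
  have huv := hcv.mono hcu hv
  have huw : u.Antipodal w :=
    Gam.antipodal_of_isMax hw (fun h => hcw.2.1 (hcu.trans h)) hv huv hwv
  obtain h | h | h := hf.eq_or_eq_or_eq hv hcv huv hwv
  · exact h
  · exact absurd h (hf.ne_of_antipodal _ _ hcw)
  · exact absurd h (hf.ne_of_antipodal _ _ huw)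

variable {o : UpperOrdering G Q} {i j : Fin (ell G Q)}

theorem ne_upper_of_le_of_le (hij : i ≠ j) (hi : c ≤ o i) (hj : c ≤ o j) :
    f (o i) ≠ f (o j) := by
  obtain ⟨v, hv, hcv⟩ := exists_neighborOf_of_le_of_le hij hi hj
  exact hf.ne_of_antipodal _ _ (upper_antipodal hij hv (hcv.mono hi hv) (hcv.mono hj hv))

theorem eq_or_eq_of_mem_D₂ (hij : i ≠ j) (hc : c ∈ D₂ o i j) :
    f c = f (o i) ∨ f c = f (o j) := by
  obtain ⟨v, hv, hcv⟩ := exists_neighborOf_of_le_of_le hij hc.1 hc.2.1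
  obtain h | h | h := hf.eq_or_eq_or_eq hv hcv (hcv.mono hc.1 hv) (hcv.mono hc.2.1 hv)
  · exact .inl h
  · exact .inr h
  · exact absurd h (hf.ne_upper_of_le_of_le hij hc.1 hc.2.1)

theorem ne_of_antipodal_D₁ (hij : i ≠ j) (hj : c ≤ o j) (hc' : c' ∈ D₁ o i)
    (hcc' : c.Antipodal c') : f c ≠ f (o i) := by
  obtain ⟨v, hv, hcv, hcv'⟩ := Gam.attached_iff.mp hcc'.1
  have hanti : c'.Antipodal (o j) :=
    antipodal_upper_of_mem_D₁ hc' hij hv hcv' (hcv.mono hj hv)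
  rw [← hf.eq_of_antipodal_isMax (isMax_upper o j) hc'.1 hanti]
  exact hf.ne_of_antipodal _ _ hcc'

theorem weakColor_eq (hi : c ≤ o i) (hfi : f c = f (o i)) : weakColor o f c = i.castSucc := by
  have h : ∃ i, c ≤ (o i : Gam G Q) ∧ f c = f (o i) := ⟨i, hi, hfi⟩
  have hchoose : h.choose = i := by
    by_contra hne
    exact hf.ne_upper_of_le_of_le hne h.choose_spec.1 hi (h.choose_spec.2 ▸ hfi)
  rw [weakColor, dif_pos h, hchoose]

omit hf in
theorem weakColor_eq_last (hc : c ∈ D₁ o i) (hfi : f c ≠ f (o i)) :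
    weakColor o f c = Fin.last _ := by
  refine dif_neg ?_
  rintro ⟨k, hk, hfk⟩
  obtain rfl | hki := eq_or_ne k i
  exacts [hfi hfk, hc.2 k hki hk]

theorem weakColor_eq_of_antipodal_D₁ (hij : i ≠ j) (hc : c ∈ D₂ o i j) (hc' : c' ∈ D₁ o i)
    (hcc' : c.Antipodal c') : weakColor o f c = j.castSucc :=
  hf.weakColor_eq hc.2.1 ((hf.eq_or_eq_of_mem_D₂ hij hc).resolve_left
    (hf.ne_of_antipodal_D₁ hij hc.2.1 hc' hcc'))

theorem weakColor_ne_of_mem_D₁ (hc : c ∈ D₁ o i) (hc' : c' ∈ D₁ o i)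
    (hcc' : c.Antipodal c') : weakColor o f c ≠ weakColor o f c' := by
  obtain ⟨v, hv, hcv, hcv'⟩ := Gam.attached_iff.mp hcc'.1
  have hne := hf.ne_of_antipodal _ _ hcc'
  obtain h | h | h := hf.eq_or_eq_or_eq hv hcv hcv' (hcv.mono hc.1 hv)
  · exact absurd h hne
  · rw [hf.weakColor_eq hc.1 h, weakColor_eq_last hc' (h ▸ hne.symm)]
    exact Fin.castSucc_ne_last i
  · rw [hf.weakColor_eq hc'.1 h, weakColor_eq_last hc (h ▸ hne)]
    exact (Fin.castSucc_ne_last i).symm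

theorem weakColor_ne_of_mem_D₂ (hij : i ≠ j) (hc : c ∈ D₂ o i j) (hc' : c' ∈ D₂ o i j)
    (hcc' : c.Antipodal c') : weakColor o f c ≠ weakColor o f c' := by
  have hne := hf.ne_of_antipodal _ _ hcc'
  have hij' : i.castSucc ≠ j.castSucc := (Fin.castSucc_injective _).ne hij
  obtain h | h := hf.eq_or_eq_of_mem_D₂ hij hc <;>
    obtain h' | h' := hf.eq_or_eq_of_mem_D₂ hij hc'
  · exact absurd (h.trans h'.symm) hne
  · rwa [hf.weakColor_eq hc.1 h, hf.weakColor_eq hc'.2.1 h']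
  · rw [hf.weakColor_eq hc.2.1 h, hf.weakColor_eq hc'.1 h']
    exact hij'.symm
  · exact absurd (h.trans h'.symm) hne

theorem isWeakColoring_weakColor (o : UpperOrdering G Q) :
    IsWeakColoring o (weakColor o f) where
  upper _ := hf.weakColor_eq le_rfl rfl
  single i c hc := by
    by_cases h : f c = f (o i)
    exacts [.inl (hf.weakColor_eq hc.1 h), .inr (weakColor_eq_last hc h)]
  double i j hij c hc :=
    (hf.eq_or_eq_of_mem_D₂ hij.ne hc).imp (hf.weakColor_eq hc.1) (hf.weakColor_eq hc.2.1)
  single_antipodal := by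
    rintro i c hc ⟨u, hu, hcu⟩
    exact hf.weakColor_eq hc.1
      (hf.eq_of_antipodal_isMax (Gam.mem_upper_iff_isMax.mp hu) hc.1 hcu)
  double_antipodal i j hij c hc :=
    ⟨fun ⟨_, hc', h⟩ => hf.weakColor_eq_of_antipodal_D₁ hij.ne hc hc' h,
      fun ⟨_, hc', h⟩ =>
        hf.weakColor_eq_of_antipodal_D₁ hij.ne' (D₂_comm (o := o) i j ▸ hc) hc' h⟩
  proper := by
    rintro _ (⟨i, rfl⟩ | ⟨i, j, hij, rfl⟩) c hc c' hc' hcc'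
    exacts [hf.weakColor_ne_of_mem_D₁ hc hc' hcc', hf.weakColor_ne_of_mem_D₂ hij.ne hc hc' hcc']

end IsStrongColoring

namespace IsWeakColoring

variable {o : UpperOrdering G Q} {g : Gam G Q → Fin (ell G Q + 1)} {i j : Fin (ell G Q)}
  {c c' : Gam G Q} {v : V}

theorem double_of_ne (hg : IsWeakColoring o g) (hij : i ≠ j) (hc : c ∈ D₂ o i j) :
    g c = i.castSucc ∨ g c = j.castSucc := by
  obtain h | h := hij.lt_or_gt
  exacts [hg.double i j h c hc, (hg.double j i h c (D₂_comm (o := o) i j ▸ hc)).symm]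

theorem double_antipodal_of_ne (hg : IsWeakColoring o g) (hij : i ≠ j) (hc : c ∈ D₂ o i j)
    (hc' : c' ∈ D₁ o i) (hcc' : c.Antipodal c') : g c = j.castSucc := by
  obtain h | h := hij.lt_or_gt
  · exact (hg.double_antipodal i j h c hc).1 ⟨c', hc', hcc'⟩
  · exact (hg.double_antipodal j i h c (D₂_comm (o := o) i j ▸ hc)).2 ⟨c', hc', hcc'⟩

theorem D₂_mem_skeleton (hij : i ≠ j) : D₂ o i j ∈ skeleton o := by
  obtain h | h := hij.lt_or_gt
  exacts [.inr ⟨i, j, h, rfl⟩, .inr ⟨j, i, h, D₂_comm i j⟩]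

theorem single_of_neighborOf (hg : IsWeakColoring o g) (hij : i ≠ j) (hv : v ∈ Q)
    (hj : (o j : Gam G Q).NeighborOf v) (hc : c ∈ D₁ o i) (hcv : c.NeighborOf v) :
    g c = i.castSucc :=
  hg.single_antipodal i c hc ⟨_, (o j).2, antipodal_upper_of_mem_D₁ hc hij hv hcv hj⟩

theorem ne_of_mem_D₁_of_mem_D₂ (hg : IsWeakColoring o g) (hij : i ≠ j) (hc : c ∈ D₁ o i)
    (hc' : c' ∈ D₂ o i j) (hcc' : c.Antipodal c') : g c ≠ g c' := by
  obtain ⟨v, hv, hcv, hcv'⟩ := Gam.attached_iff.mp hcc'.1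
  rw [hg.single_of_neighborOf hij hv (hcv'.mono hc'.2.1 hv) hc hcv,
    hg.double_antipodal_of_ne hij hc' hc hcc'.symm]
  exact (Fin.castSucc_injective _).ne hij

section NoTriple

variable (htriple : ¬ ∃ a ∈ Upper G Q, ∃ b ∈ Upper G Q, ∃ c ∈ Upper G Q,
  IsFullAntipodalTriple a b c)

include htriple

theorem eq_or_eq_of_upper_neighborOf {k : Fin (ell G Q)} (hv : v ∈ Q) (hij : i ≠ j)
    (hi : (o i : Gam G Q).NeighborOf v) (hj : (o j : Gam G Q).NeighborOf v)
    (hk : (o k : Gam G Q).NeighborOf v) : k = i ∨ k = j := by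
  by_contra! h
  exact htriple ⟨_, (o i).2, _, (o j).2, _, (o k).2, upper_antipodal hij hv hi hj,
    upper_antipodal h.1.symm hv hi hk, upper_antipodal h.2.symm hv hj hk, v, hv, hi, hj, hk⟩

variable [Finite V]

theorem mem_D₁_or_mem_D₂ (hv : v ∈ Q) (hij : i ≠ j) (hi : (o i : Gam G Q).NeighborOf v)
    (hj : (o j : Gam G Q).NeighborOf v) (hc : c.NeighborOf v) :
    c ∈ D₁ o i ∨ c ∈ D₁ o j ∨ c ∈ D₂ o i j := by
  have hk : ∀ k, c ≤ o k → k = i ∨ k = j := fun k hk =>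
    eq_or_eq_of_upper_neighborOf htriple hv hij hi hj (hc.mono hk hv)
  obtain ⟨k, hck⟩ := exists_le_upper o c
  simp only [D₁, D₂, Set.mem_ofPred_eq]
  grind

omit htriple in
theorem mem_D₁_of_unique_upper (hv : v ∈ Q)
    (hi : ∀ k, (o k : Gam G Q).NeighborOf v → k = i) (hc : c.NeighborOf v) : c ∈ D₁ o i := by
  obtain ⟨k, hck⟩ := exists_le_upper o c
  obtain rfl := hi k (hc.mono hck hv)
  exact ⟨hck, fun l hlk hcl => hlk (hi l (hc.mono hcl hv))⟩

variable (hg : IsWeakColoring o g)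

include hg

theorem color_ne_of_antipodal (hcc' : c.Antipodal c') : g c ≠ g c' := by
  obtain ⟨v, hv, hcv, hcv'⟩ := Gam.attached_iff.mp hcc'.1
  obtain ⟨i, hci⟩ := exists_le_upper o c
  have hi := hcv.mono hci hv
  by_cases h : ∃ j, i ≠ j ∧ (o j : Gam G Q).NeighborOf v
  · obtain ⟨j, hij, hj⟩ := h
    have mem : ∀ {d : Gam G Q}, d.NeighborOf v → d ∈ D₁ o i ∨ d ∈ D₁ o j ∨ d ∈ D₂ o i j :=
      mem_D₁_or_mem_D₂ htriple hv hij hi hj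
    have hne : i.castSucc ≠ j.castSucc := (Fin.castSucc_injective _).ne hij
    obtain hc | hc | hc := mem hcv <;> obtain hc' | hc' | hc' := mem hcv'
    · exact hg.proper _ (.inl ⟨i, rfl⟩) c hc c' hc' hcc'
    · rwa [hg.single_of_neighborOf hij hv hj hc hcv,
        hg.single_of_neighborOf hij.symm hv hi hc' hcv']
    · exact hg.ne_of_mem_D₁_of_mem_D₂ hij hc hc' hcc'
    · rw [hg.single_of_neighborOf hij.symm hv hi hc hcv,
        hg.single_of_neighborOf hij hv hj hc' hcv']
      exact hne.symm
    · exact hg.proper _ (.inl ⟨j, rfl⟩) c hc c' hc' hcc'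
    · exact hg.ne_of_mem_D₁_of_mem_D₂ hij.symm hc (D₂_comm (o := o) i j ▸ hc') hcc'
    · exact (hg.ne_of_mem_D₁_of_mem_D₂ hij hc' hc hcc'.symm).symm
    · exact (hg.ne_of_mem_D₁_of_mem_D₂ hij.symm hc' (D₂_comm (o := o) i j ▸ hc) hcc'.symm).symm
    · exact hg.proper _ (D₂_mem_skeleton hij) c hc c' hc' hcc'
  · have hunique : ∀ k, (o k : Gam G Q).NeighborOf v → k = i := fun k hk => by
      by_contra hki
      exact h ⟨k, Ne.symm hki, hk⟩
    exact hg.proper _ (.inl ⟨i, rfl⟩) c (mem_D₁_of_unique_upper hv hunique hcv)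
      c' (mem_D₁_of_unique_upper hv hunique hcv') hcc'

theorem exists_two_colors (hv : v ∈ Q) :
    ∃ a b, ∀ c : Gam G Q, c.NeighborOf v → g c = a ∨ g c = b := by
  by_cases hex : ∃ i, (o i : Gam G Q).NeighborOf v
  · obtain ⟨i, hi⟩ := hex
    by_cases h : ∃ j, i ≠ j ∧ (o j : Gam G Q).NeighborOf v
    · obtain ⟨j, hij, hj⟩ := h
      refine ⟨i.castSucc, j.castSucc, fun c hcv => ?_⟩
      obtain hc | hc | hc := mem_D₁_or_mem_D₂ htriple hv hij hi hj hcv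
      exacts [.inl (hg.single_of_neighborOf hij hv hj hc hcv),
        .inr (hg.single_of_neighborOf hij.symm hv hi hc hcv), hg.double_of_ne hij hc]
    · refine ⟨i.castSucc, Fin.last _, fun c hcv => hg.single i c ?_⟩
      refine mem_D₁_of_unique_upper hv (fun k hk => ?_) hcv
      by_contra hki
      exact h ⟨k, Ne.symm hki, hk⟩
  · refine ⟨Fin.last _, Fin.last _, fun c hcv => absurd ?_ hex⟩
    obtain ⟨i, hci⟩ := exists_le_upper o c
    exact ⟨i, hcv.mono hci hv⟩

theorem isStrongColoring : IsStrongColoring g where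
  ne_of_antipodal _ _ := color_ne_of_antipodal htriple hg
  two_colors _ := exists_two_colors htriple hg

end NoTriple

end IsWeakColoring

end Coloring

section Tree

variable {W : Type*} {T : SimpleGraph W} {A : Set W} {r x y z t : W}

theorem exists_walk_of_connected (hA : (T.induce A).Connected) (hx : x ∈ A) (hy : y ∈ A) :
    ∃ p : T.Walk x y, ∀ z ∈ p.support, z ∈ A := by
  obtain ⟨p⟩ := hA ⟨x, hx⟩ ⟨y, hy⟩
  refine ⟨p.map (Embedding.induce A).toHom, fun z hz => ?_⟩
  obtain ⟨w, -, rfl⟩ := List.mem_map.mp (Walk.support_map _ p ▸ hz)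
  exact w.2

theorem isPath_append {a b c : W} {p : T.Walk a b} {q : T.Walk b c} (hp : p.IsPath)
    (hq : q.IsPath) (h : ∀ x ∈ p.support, x ∈ q.support → x = b) : (p.append q).IsPath := by
  induction p with
  | nil => simpa using hq
  | cons e p ih =>
    rw [Walk.cons_isPath_iff] at hp
    rw [Walk.cons_append, Walk.cons_isPath_iff, Walk.mem_support_append_iff]
    refine ⟨ih hp.1 hq fun x hx => h x (by simp [hx]), ?_⟩
    rintro (hmem | hmem)
    · exact hp.2 hmem
    · obtain rfl := h _ (by simp) hmem
      exact hp.2 p.end_mem_support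

/-- `x` is an ancestor of `y` with respect to the root `r`: every walk from `r` to `y` visits
`x`. -/
def IsAncestor (T : SimpleGraph W) (r x y : W) : Prop := ∀ p : T.Walk r y, x ∈ p.support

namespace IsAncestor

theorem trans (hxy : IsAncestor T r x y) (hyz : IsAncestor T r y z) : IsAncestor T r x z := by
  classical
  exact fun p => p.support_takeUntil_subset_support (hyz p) (hxy _)

theorem antisymm (hT : T.Connected) (hxy : IsAncestor T r x y) (hyx : IsAncestor T r y x) :
    x = y := by
  classical
  obtain ⟨p, hp⟩ := hT.exists_isPath r y
  by_contra hne
  exact Walk.endpoint_notMem_support_takeUntil hp (hxy p) (Ne.symm hne) (hyx _)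

theorem iff_mem_support (hT : T.IsAcyclic) {p : T.Walk r y} (hp : p.IsPath) :
    IsAncestor T r x y ↔ x ∈ p.support := by
  classical
  refine ⟨fun h => h p, fun h q => ?_⟩
  have hqp : q.bypass = p :=
    congrArg Subtype.val ((hT.subsingleton_path r y).elim ⟨q.bypass, q.bypass_isPath⟩ ⟨p, hp⟩)
  exact q.support_bypass_subset_support (hqp ▸ h)

theorem of_getVert (hT : T.IsAcyclic) {p : T.Walk r z} (hp : p.IsPath) {i j : ℕ}
    (hij : i ≤ j) : IsAncestor T r (p.getVert i) (p.getVert j) := by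
  rw [iff_mem_support hT (hp.take j)]
  have := (p.take j).getVert_mem_support i
  rwa [Walk.take_getVert, min_eq_right hij] at this

theorem total (hT : T.IsTree) (hx : IsAncestor T r x z) (hy : IsAncestor T r y z) :
    IsAncestor T r x y ∨ IsAncestor T r y x := by
  obtain ⟨p, hp⟩ := hT.connected.exists_isPath r z
  obtain ⟨i, rfl, -⟩ := Walk.mem_support_iff_exists_getVert.mp (hx p)
  obtain ⟨j, rfl, -⟩ := Walk.mem_support_iff_exists_getVert.mp (hy p)
  exact (le_total i j).imp (of_getVert hT.isAcyclic hp) (of_getVert hT.isAcyclic hp)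

theorem dist_lt (hT : T.Connected) (h : IsAncestor T r x y) (hne : x ≠ y) :
    T.dist r x < T.dist r y := by
  classical
  obtain ⟨p, hp⟩ := hT.exists_walk_length_eq_dist r y
  rw [← hp]
  exact (dist_le _).trans_lt (Walk.length_takeUntil_lt_length (h p) hne)

theorem mem_of_connected (hT : T.IsTree) (hA : (T.induce A).Connected) (ht : t ∈ A) (hz : z ∈ A)
    (hty : IsAncestor T r t y) (hyz : IsAncestor T r y z) : y ∈ A := by
  obtain ⟨p, hp⟩ := hT.connected.exists_isPath r t
  obtain ⟨q, hq⟩ := exists_walk_of_connected hA ht hz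
  obtain hyp | hyq := (Walk.mem_support_append_iff _ _).mp (hyz (p.append q))
  · rwa [← antisymm hT.connected hty ((iff_mem_support hT.isAcyclic hp).mpr hyp)]
  · exact hq y hyq

theorem exists_adj (hT : T.IsTree) (h : t ≠ r) : ∃ x, T.Adj r x ∧ IsAncestor T r x t := by
  obtain ⟨p, hp⟩ := hT.connected.exists_isPath r t
  exact ⟨p.snd, p.adj_snd fun hnil => h hnil.eq.symm,
    (iff_mem_support hT.isAcyclic hp).mpr (p.getVert_mem_support 1)⟩

theorem eq_of_adj (hx : T.Adj r x) (hy : T.Adj r y) (h : IsAncestor T r x y) : x = y := by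
  have hmem := h (Walk.cons hy Walk.nil)
  simp only [Walk.support_cons, Walk.support_nil, List.mem_cons, List.not_mem_nil,
    or_false] at hmem
  exact hmem.resolve_left hx.ne'

theorem eq_of_adj_of_adj (hT : T.IsTree) (hx : T.Adj r x) (hy : T.Adj r y)
    (hxz : IsAncestor T r x z) (hyz : IsAncestor T r y z) : x = y :=
  (hxz.total hT hyz).elim (eq_of_adj hx hy) fun h => (eq_of_adj hy hx h).symm

end IsAncestor

theorem exists_isAncestor_of_connected (hT : T.IsTree) (hA : (T.induce A).Connected) (r : W) :
    ∃ t ∈ A, ∀ z ∈ A, IsAncestor T r t z := by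
  classical
  obtain ⟨t, ht, hmin⟩ : ∃ t ∈ A, ∀ z ∈ A, T.dist r t ≤ T.dist r z := by
    obtain ⟨t, ht⟩ := exists_minimalFor_of_wellFoundedLT (· ∈ A) (T.dist r)
      (Set.nonempty_coe_sort.mp hA.nonempty)
    exact ⟨t, ht.1, fun z hz => (le_total _ _).elim id (ht.2 hz)⟩
  refine ⟨t, ht, fun z hz => ?_⟩
  obtain ⟨p, hp⟩ := hT.connected.exists_isPath r t
  obtain ⟨q, hq⟩ := exists_walk_of_connected hA ht hz
  have hpath : (p.append q.bypass).IsPath := by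
    refine isPath_append hp q.bypass_isPath fun x hxp hxq => ?_
    by_contra hne
    have hlt := ((IsAncestor.iff_mem_support hT.isAcyclic hp).mpr hxp).dist_lt hT.connected hne
    exact hlt.not_ge (hmin x (hq x (q.support_bypass_subset_support hxq)))
  rw [IsAncestor.iff_mem_support hT.isAcyclic hpath, Walk.mem_support_append_iff]
  exact .inl p.end_mem_support

/-- The Helly property of subtrees. -/
theorem exists_mem_of_pairwise_inter (hT : T.IsTree) {ι : Type*} [Finite ι] {A : ι → Set W}
    (hA : ∀ i, (T.induce (A i)).Connected) (hinter : ∀ i j, (A i ∩ A j).Nonempty) :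
    ∃ x, ∀ i, x ∈ A i := by
  have : Nonempty W := hT.connected.nonempty
  let r : W := Classical.arbitrary W
  obtain hι | hι := isEmpty_or_nonempty ι
  · exact ⟨r, fun i => hι.elim i⟩
  choose t ht htop using fun i => exists_isAncestor_of_connected hT (hA i) r
  obtain ⟨i, hi⟩ := Finite.exists_max fun i => T.dist r (t i)
  refine ⟨t i, fun j => ?_⟩
  obtain ⟨z, hzi, hzj⟩ := hinter i j
  refine (htop j z hzj).total hT (htop i z hzi) |>.elim
    (fun h => h.mem_of_connected hT (hA j) (ht j) hzj (htop i z hzi)) fun h => ?_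
  obtain heq | hne := eq_or_ne (t i) (t j)
  · exact heq ▸ ht j
  · exact absurd (hi j) (h.dist_lt hT.connected hne).not_ge

end Tree

section PathVertexSet

variable {W : Type u} {T : SimpleGraph W} {P : Set W} {r : W}

theorem IsPathVertexSet.connected (hP : IsPathVertexSet T P) : (T.induce P).Connected := by
  obtain ⟨_, _, p, -, rfl⟩ := hP
  exact p.connected_induce_support

theorem IsPathVertexSet.exists_ends (hT : T.IsTree) (hP : IsPathVertexSet T P) (hr : r ∈ P) :
    ∃ a b, (∀ z, z ∈ P ↔ IsAncestor T r z a ∨ IsAncestor T r z b) ∧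
      ∀ z, IsAncestor T r z a → IsAncestor T r z b → z = r := by
  classical
  obtain ⟨a, b, p, hp, rfl⟩ := hP
  have ha : ∀ z, IsAncestor T r z a ↔ z ∈ (p.takeUntil r hr).support := fun z => by
    rw [IsAncestor.iff_mem_support hT.isAcyclic (hp.takeUntil hr).reverse, Walk.support_reverse,
      List.mem_reverse]
  have hb : ∀ z, IsAncestor T r z b ↔ z ∈ (p.dropUntil r hr).support := fun z =>
    IsAncestor.iff_mem_support hT.isAcyclic (hp.dropUntil hr)
  refine ⟨a, b, fun z => ?_, fun z hza hzb => ?_⟩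
  · rw [ha, hb, ← Walk.mem_support_append_iff, Walk.take_spec]
    rfl
  · rw [ha] at hza
    rw [hb] at hzb
    by_contra hne
    rw [← p.take_spec hr] at hp
    exact hp.ne_of_mem_support_of_append hne hza hzb rfl

theorem IsPathVertexSet.mem_of_isAncestor (hT : T.IsTree) (hP : IsPathVertexSet T P)
    (hr : r ∈ P) {x y : W} (hxy : IsAncestor T r x y) (hy : y ∈ P) : x ∈ P :=
  IsAncestor.mem_of_connected hT hP.connected hr hy (fun p => p.start_mem_support) hxy

/-- Nodes of `P` in the same branch at `r` lie on the same one of the two arms of `P` at `r`. -/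
theorem IsPathVertexSet.isAncestor_total (hT : T.IsTree) (hP : IsPathVertexSet T P) (hr : r ∈ P)
    {c x y : W} (hc : c ≠ r) (hcx : IsAncestor T r c x) (hcy : IsAncestor T r c y)
    (hx : x ∈ P) (hy : y ∈ P) : IsAncestor T r x y ∨ IsAncestor T r y x := by
  obtain ⟨a, b, hab, hr'⟩ := hP.exists_ends hT hr
  rw [hab] at hx hy
  obtain hx | hx := hx <;> obtain hy | hy := hy
  · exact hx.total hT hy
  · exact absurd (hr' c (hcx.trans hx) (hcy.trans hy)) hc
  · exact absurd (hr' c (hcy.trans hy) (hcx.trans hx)) hc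
  · exact hx.total hT hy

theorem IsPathVertexSet.exists_two_branches (hT : T.IsTree) (hP : IsPathVertexSet T P)
    (hr : r ∈ P) : ∃ a b, ∀ c, T.Adj r c → c ∈ P → c = a ∨ c = b := by
  obtain ⟨e, e', he, -⟩ := hP.exists_ends hT hr
  have hunique : ∀ e, ∃ a, ∀ c, T.Adj r c → IsAncestor T r c e → c = a := fun e => by
    by_cases h : ∃ a, T.Adj r a ∧ IsAncestor T r a e
    · obtain ⟨a, ha, hae⟩ := h
      exact ⟨a, fun c hc hce => IsAncestor.eq_of_adj_of_adj hT hc ha hce hae⟩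
    · exact ⟨r, fun c hc hce => absurd ⟨c, hc, hce⟩ h⟩
  obtain ⟨a, ha⟩ := hunique e
  obtain ⟨b, hb⟩ := hunique e'
  exact ⟨a, b, fun c hc hcP => ((he c).mp hcP).imp (ha c hc) (hb c hc)⟩

end PathVertexSet

section Parts

variable {V : Type u} {G : SimpleGraph V} {Q K : Set V} {γ γ' : SepPart G Q} {v w : V}

namespace SepPart

theorem notMem_of_mem_supp (hv : v ∈ γ.comp.supp) : v ∉ Q := hv.choose

theorem eq_of_mem_supp (hv : v ∈ γ.comp.supp) (hv' : v ∈ γ'.comp.supp) : γ = γ' :=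
  SepPart.ext (hv.choose_spec.symm.trans hv'.choose_spec)

theorem exists_mem_supp (hv : v ∉ Q) : ∃ γ : SepPart G Q, v ∈ γ.comp.supp :=
  ⟨⟨G.componentComplMk hv⟩, G.componentComplMk_mem hv⟩

theorem mem_verts_of_adj (hv : v ∈ γ.comp.supp) (h : G.Adj v w) : w ∈ γ.verts :=
  (em (w ∈ Q)).elim .inr fun hw => .inl (ComponentCompl.mem_of_adj v w hv hw h)

theorem connected_supp (γ : SepPart G Q) : (G.induce γ.comp.supp).Connected :=
  (ConnectedComponent.connected_toSimpleGraph γ.comp).map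
    { toFun := fun x => ⟨x.1, x.1.2, x.2⟩, map_rel' := id } <| by
    rintro ⟨x, hx, hxγ⟩
    exact ⟨⟨⟨x, hx⟩, hxγ⟩, rfl⟩

theorem Relevant.isClique (h : γ.Relevant K) : G.IsClique K := h.1.1.2

theorem Relevant.subset_verts (h : γ.Relevant K) : K ⊆ γ.verts := h.1.1.1

theorem Relevant.exists_mem_supp (hQ : G.IsClique Q) (h : γ.Relevant K) :
    ∃ c ∈ K, c ∈ γ.comp.supp := by
  by_contra! hne
  have hKQ : K ⊆ Q := fun x hx => (h.subset_verts hx).resolve_left (hne x hx)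
  exact h.2.2 (hKQ.antisymm (h.1.2 ⟨Set.subset_union_right, hQ⟩ hKQ))

theorem NeighborOf.exists_adj (hQ : G.IsClique Q) (h : γ.NeighborOf v) (hv : v ∈ Q) :
    ∃ c ∈ γ.comp.supp, G.Adj v c := by
  obtain ⟨K, hK, hvK⟩ := h
  obtain ⟨c, hcK, hc⟩ := hK.exists_mem_supp hQ
  exact ⟨c, hc, hK.isClique hvK hcK fun h => notMem_of_mem_supp hc (h ▸ hv)⟩

end SepPart

theorem IsStrongColoring.of_sepPart {α : Type*} {f : SepPart G Q → α}
    (hcomp : ∀ γ γ', γ.Attached γ' → f γ = f γ' → γ ≤ γ' ∨ γ' ≤ γ)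
    (htwo : ∀ v ∈ Q, ∃ a b, ∀ γ, γ.NeighborOf v → f γ = a ∨ f γ = b) :
    IsStrongColoring fun c : Gam G Q => f (ofAntisymmetrization (· ≤ ·) c) := by
  have hcls : ∀ c : Gam G Q, (ofAntisymmetrization (· ≤ ·) c).cls = c :=
    toAntisymmetrization_ofAntisymmetrization _
  have hnb : ∀ (c : Gam G Q), ∀ v ∈ Q, c.NeighborOf v →
      (ofAntisymmetrization (· ≤ ·) c).NeighborOf v := fun c v hv h =>
    (SepPart.neighborOf_cls hv).mp ((hcls c).symm ▸ h)
  constructor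
  · rintro c c' ⟨hatt, hle, hge⟩ heq
    obtain ⟨v, hv, h, h'⟩ := Gam.attached_iff.mp hatt
    have := hcomp _ _ (SepPart.attached_iff.mpr ⟨v, hv, hnb c v hv h, hnb c' v hv h'⟩) heq
    rw [← SepPart.cls_le_cls, ← SepPart.cls_le_cls, hcls, hcls] at this
    exact this.elim hle hge
  · intro v hv
    obtain ⟨a, b, hab⟩ := htwo v hv
    exact ⟨a, b, fun c hc => hab _ (hnb c v hv hc)⟩

end Parts

section PathRepresentation

/-- The paths `φ v` of the tree `T` represent the graph `G` as an intersection graph. Different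
vertices are allowed to have the same path. -/
structure IsPathRepresentation {V W : Type u} (G : SimpleGraph V) (T : SimpleGraph W)
    (φ : V → Set W) : Prop where
  isTree : T.IsTree
  isPath : ∀ v, IsPathVertexSet T (φ v)
  adj_iff : ∀ v w, v ≠ w → (G.Adj v w ↔ (φ v ∩ φ w).Nonempty)

variable {V W : Type u} {G : SimpleGraph V} {T : SimpleGraph W} {φ : V → Set W} {Q K : Set V}
  {v w : V} {x y : W}

/-- The nodes of the host tree on the paths of the vertices of `C`. -/
def region (φ : V → Set W) (C : Set V) : Set W := ⋃ v ∈ C, φ v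

theorem mem_region {C : Set V} : x ∈ region φ C ↔ ∃ v ∈ C, x ∈ φ v := by
  simp only [region, Set.mem_iUnion, exists_prop]

namespace IsPathRepresentation

variable (h : IsPathRepresentation G T φ)

include h

theorem inter_nonempty (hvw : G.Adj v w) : (φ v ∩ φ w).Nonempty :=
  (h.adj_iff v w hvw.ne).mp hvw

theorem adj_of_mem (hne : v ≠ w) (hv : x ∈ φ v) (hw : x ∈ φ w) : G.Adj v w :=
  (h.adj_iff v w hne).mpr ⟨x, hv, hw⟩

theorem exists_common_mem [Finite V] (hK : G.IsClique K) : ∃ x, ∀ v ∈ K, x ∈ φ v := by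
  obtain ⟨x, hx⟩ := exists_mem_of_pairwise_inter h.isTree (A := fun v : K => φ v)
    (fun v => (h.isPath v).connected) fun v w => by
      obtain hvw | hvw := eq_or_ne (v : V) w
      · rw [hvw, Set.inter_self]
        exact Set.nonempty_coe_sort.mp (h.isPath w).connected.nonempty
      · exact h.inter_nonempty (hK v.2 w.2 hvw)
  exact ⟨x, fun v hv => hx ⟨v, hv⟩⟩

theorem isClique_insert (hK : G.IsClique K) (hx : ∀ v ∈ K, x ∈ φ v) (hw : x ∈ φ w) :
    G.IsClique (insert w K) :=
  hK.insert fun v hv hne => h.adj_of_mem hne hw (hx v hv)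

theorem connected_region {C : Set V} (hC : (G.induce C).Connected) :
    (T.induce (region φ C)).Connected := by
  obtain ⟨⟨c, hc⟩⟩ := hC.nonempty
  have hpatch : ∀ d : C, (G.induce C).Walk ⟨c, hc⟩ d →
      ∃ A ⊆ region φ C, φ c ⊆ A ∧ φ d ⊆ A ∧ (T.induce A).Connected := by
    suffices ∀ a b : C, (G.induce C).Walk a b →
        ∃ A ⊆ region φ C, φ a ⊆ A ∧ φ b ⊆ A ∧ (T.induce A).Connected from this ⟨c, hc⟩
    intro a b p
    induction p with
    | @nil a =>
      exact ⟨φ a, Set.subset_biUnion_of_mem a.2, subset_rfl, subset_rfl, (h.isPath a).connected⟩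
    | @cons a b d hab _ ih =>
      obtain ⟨A, hA, hbA, hdA, hAconn⟩ := ih
      refine ⟨φ a ∪ A, Set.union_subset (Set.subset_biUnion_of_mem a.2) hA,
        Set.subset_union_left, hdA.trans Set.subset_union_right, ?_⟩
      exact induce_union_connected (h.isPath a).connected.preconnected hAconn.preconnected
        ((h.inter_nonempty hab).mono (Set.inter_subset_inter_right _ hbA))
  obtain ⟨x, hx⟩ := (h.isPath c).connected.nonempty
  refine induce_connected_of_patches x (mem_region.mpr ⟨c, hc, hx⟩) fun {y} hy => ?_
  obtain ⟨d, hd, hyd⟩ := mem_region.mp hy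
  obtain ⟨p⟩ := hC ⟨c, hc⟩ ⟨d, hd⟩
  obtain ⟨A, hA, hcA, hdA, hconn⟩ := hpatch ⟨d, hd⟩ p
  exact ⟨A, hA, hcA hx, hdA hyd, hconn _ _⟩

theorem eq_of_mem_region {γ γ' : SepPart G Q} (hγ : x ∈ region φ γ.comp.supp)
    (hγ' : x ∈ region φ γ'.comp.supp) : γ = γ' := by
  obtain ⟨v, hv, hxv⟩ := mem_region.mp hγ
  obtain ⟨w, hw, hxw⟩ := mem_region.mp hγ'
  obtain rfl | hne := eq_or_ne v w
  · exact SepPart.eq_of_mem_supp hv hw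
  · exact SepPart.eq_of_mem_supp (ComponentCompl.mem_of_adj v w hv
      (SepPart.notMem_of_mem_supp hw) (h.adj_of_mem hne hxv hxw)) hw

end IsPathRepresentation

/-- The host tree rooted at a common node of the paths of the maximal clique `Q`. The regions of
the parts at `Q` are then subtrees avoiding the root; each is given with its node nearest to the
root and with the neighbor of the root in whose direction it lies. -/
structure Rooting (G : SimpleGraph V) (T : SimpleGraph W) (φ : V → Set W) (Q : Set V) where
  root : W
  root_mem : ∀ v ∈ Q, root ∈ φ v
  top : SepPart G Q → W
  top_mem : ∀ γ, top γ ∈ region φ γ.comp.supp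
  top_isAncestor : ∀ γ, ∀ x ∈ region φ γ.comp.supp, IsAncestor T root (top γ) x
  branch : SepPart G Q → W
  adj_branch : ∀ γ, T.Adj root (branch γ)
  branch_isAncestor : ∀ γ, IsAncestor T root (branch γ) (top γ)

namespace IsPathRepresentation

theorem nonempty_rooting [Finite V] (h : IsPathRepresentation G T φ)
    (hQ : Maximal G.IsClique Q) : Nonempty (Rooting G T φ Q) := by
  obtain ⟨r, hr⟩ := h.exists_common_mem hQ.1
  choose t ht htop using fun γ : SepPart G Q =>
    exists_isAncestor_of_connected h.isTree (h.connected_region γ.connected_supp) r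
  have htr : ∀ γ, t γ ≠ r := fun γ heq => by
    obtain ⟨v, hv, htv⟩ := mem_region.mp (ht γ)
    exact SepPart.notMem_of_mem_supp hv (hQ.2 (h.isClique_insert hQ.1 hr (heq ▸ htv))
      (Set.subset_insert v Q) (Set.mem_insert v Q))
  choose b hb hbt using fun γ => IsAncestor.exists_adj h.isTree (htr γ)
  exact ⟨⟨r, hr, t, ht, htop, b, hb, hbt⟩⟩

variable (h : IsPathRepresentation G T φ) (R : Rooting G T φ Q) (hQ : G.IsClique Q)
  {γ γ' : SepPart G Q}

include h hQ

theorem top_mem_of_neighborOf (hv : v ∈ Q) (hγ : γ.NeighborOf v) : R.top γ ∈ φ v := by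
  obtain ⟨c, hc, hvc⟩ := hγ.exists_adj hQ hv
  obtain ⟨x, hxv, hxc⟩ := h.inter_nonempty hvc
  exact (h.isPath v).mem_of_isAncestor h.isTree (R.root_mem v hv)
    (R.top_isAncestor γ x (mem_region.mpr ⟨c, hc, hxc⟩)) hxv

theorem branch_mem_of_neighborOf (hv : v ∈ Q) (hγ : γ.NeighborOf v) : R.branch γ ∈ φ v :=
  (h.isPath v).mem_of_isAncestor h.isTree (R.root_mem v hv) (R.branch_isAncestor γ)
    (h.top_mem_of_neighborOf R hQ hv hγ)

theorem le_of_isAncestor_top [Finite V] (hatt : γ.Attached γ') (hbranch : R.branch γ = R.branch γ')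
    (htop : IsAncestor T R.root (R.top γ') (R.top γ)) : γ ≤ γ' := by
  obtain rfl | hne := eq_or_ne γ γ'
  · exact le_rfl
  refine .inr ⟨hatt, fun K' hK' => ?_⟩
  obtain ⟨x, hx⟩ := h.exists_common_mem hK'.isClique
  have hxγ' : x ∈ region φ γ'.comp.supp := by
    obtain ⟨c, hcK', hc⟩ := hK'.exists_mem_supp hQ
    exact mem_region.mpr ⟨c, hc, hx c hcK'⟩
  have mem_K' : ∀ w ∈ Q, x ∈ φ w → w ∈ K' := fun w hw hxw =>
    hK'.1.2 ⟨Set.insert_subset (.inr hw) hK'.subset_verts, h.isClique_insert hK'.isClique hx hxw⟩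
      (Set.subset_insert w K') (Set.mem_insert w K')
  by_cases hxtop : IsAncestor T R.root x (R.top γ)
  · refine .inl fun K hK w ⟨hwK, hwQ⟩ => ⟨mem_K' w hwQ ?_, hwQ⟩
    exact (h.isPath w).mem_of_isAncestor h.isTree (R.root_mem w hwQ) hxtop
      (h.top_mem_of_neighborOf R hQ hwQ ⟨K, hK, hwK⟩)
  · refine .inr fun K hK => Set.eq_empty_iff_forall_notMem.mpr ?_
    rintro w ⟨⟨hwK, hwK'⟩, hwQ⟩
    obtain htx | hxt := (h.isPath w).isAncestor_total h.isTree (R.root_mem w hwQ)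
      (R.adj_branch γ).ne' (R.branch_isAncestor γ)
      (hbranch ▸ (R.branch_isAncestor γ').trans (R.top_isAncestor γ' x hxγ'))
      (h.top_mem_of_neighborOf R hQ hwQ ⟨K, hK, hwK⟩) (hx w hwK')
    · exact hne (h.eq_of_mem_region (R.top_mem γ) (htop.mem_of_connected h.isTree
        (h.connected_region γ'.connected_supp) (R.top_mem γ') hxγ' htx))
    · exact hxtop hxt

theorem le_or_le_of_branch_eq [Finite V] (hatt : γ.Attached γ')
    (hbranch : R.branch γ = R.branch γ') : γ ≤ γ' ∨ γ' ≤ γ := by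
  obtain ⟨v, hv, hγ, hγ'⟩ := SepPart.attached_iff.mp hatt
  obtain htop | htop := (h.isPath v).isAncestor_total h.isTree (R.root_mem v hv)
    (R.adj_branch γ).ne' (R.branch_isAncestor γ) (hbranch ▸ R.branch_isAncestor γ')
    (h.top_mem_of_neighborOf R hQ hv hγ) (h.top_mem_of_neighborOf R hQ hv hγ')
  · have hatt' := SepPart.attached_iff.mpr ⟨v, hv, hγ', hγ⟩
    exact .inr (h.le_of_isAncestor_top R hQ hatt' hbranch.symm htop)
  · exact .inl (h.le_of_isAncestor_top R hQ hatt hbranch htop)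

theorem exists_two_branches (hv : v ∈ Q) :
    ∃ a b, ∀ γ, γ.NeighborOf v → R.branch γ = a ∨ R.branch γ = b := by
  obtain ⟨a, b, hab⟩ := (h.isPath v).exists_two_branches h.isTree (R.root_mem v hv)
  exact ⟨a, b, fun γ hγ => hab _ (R.adj_branch γ) (h.branch_mem_of_neighborOf R hQ hv hγ)⟩

end IsPathRepresentation

theorem IsPathGraph.exists_isStrongColoring [Finite V] (hG : IsPathGraph G)
    (hQ : Maximal G.IsClique Q) : ∃ (α : Type u) (f : Gam G Q → α), IsStrongColoring f := by
  obtain ⟨W, -, T, φ, hT, hφ, -, hadj⟩ := hG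
  have h : IsPathRepresentation G T φ := ⟨hT, hφ, hadj⟩
  obtain ⟨R⟩ := h.nonempty_rooting hQ
  exact ⟨W, _, .of_sepPart (fun _ _ => h.le_or_le_of_branch_eq R hQ.1)
    fun _ => h.exists_two_branches R hQ.1⟩

end PathRepresentation

section Chordal

variable {V : Type u} {G : SimpleGraph V}

/-- `x 0, …, x m` is an induced path of `G`; the values of `x` beyond `m` are irrelevant. -/
def IsInducedPath (G : SimpleGraph V) (x : ℕ → V) (m : ℕ) : Prop :=
  ∀ i j, i < j → j ≤ m → x i ≠ x j ∧ (G.Adj (x i) (x j) ↔ j = i + 1)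

theorem isInducedPath_getVert {v w : V} {p : G.Walk v w} (hp : p.length = G.dist v w) :
    IsInducedPath G p.getVert p.length := by
  intro i j hij hj
  have hdist : G.dist (p.getVert i) (p.getVert j) = j - i := by
    have := length_eq_dist_of_subwalk hp
      (((p.drop i).isSubwalk_take (j - i)).trans (p.isSubwalk_drop i))
    rw [Walk.take_length, Walk.drop_length, Walk.drop_getVert] at this
    rw [show i + (j - i) = j by omega] at this
    omega
  constructor
  · intro h
    rw [h, dist_self] at hdist
    omega
  · rw [← dist_eq_one_iff_adj, hdist]
    omega

theorem cycleGraph_adj_of_lt {n : ℕ} (hn : 3 ≤ n) {a b : Fin n} (h : a < b) :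
    (cycleGraph n).Adj a b ↔ (b : ℕ) = a + 1 ∨ ((a : ℕ) = 0 ∧ (b : ℕ) = n - 1) := by
  rw [cycleGraph_adj', Fin.sub_val_of_le h.le, Fin.coe_sub_iff_lt.mpr h]
  have := b.2
  have : (a : ℕ) < b := h
  omega

namespace IsChordal

theorem not_inducedCycle (hG : IsChordal G) {n : ℕ} (hn : 4 ≤ n) (x : ℕ → V) :
    ¬ ∀ i j, i < j → j < n → x i ≠ x j ∧ (G.Adj (x i) (x j) ↔ j = i + 1 ∨ (i = 0 ∧ j = n - 1)) := by
  intro hx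
  have hinj : Function.Injective fun i : Fin n => x i := by
    intro i j hij
    by_contra hne
    rcases lt_or_gt_of_ne hne with h | h
    · exact (hx i j h j.2).1 hij
    · exact (hx j i h i.2).1 hij.symm
  refine hG n hn ⟨⟨⟨fun i => x i, hinj⟩, ?_⟩⟩
  intro i j
  change G.Adj (x i) (x j) ↔ _
  rcases lt_trichotomy i j with h | rfl | h
  · rw [cycleGraph_adj_of_lt (by omega) h, (hx i j h j.2).2]
  · simp only [SimpleGraph.irrefl]
  · rw [G.adj_comm, (cycleGraph n).adj_comm, cycleGraph_adj_of_lt (by omega) h, (hx j i h i.2).2]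

theorem adj_of_isInducedPath (hG : IsChordal G) {x : ℕ → V} {m : ℕ}
    (hx : IsInducedPath G x (m + 1)) {t : V} (ht : ∀ i ≤ m + 1, t ≠ x i) (h0 : G.Adj t (x 0))
    (hm : G.Adj t (x (m + 1))) : G.Adj t (x m) := by
  classical
  by_contra htm
  -- The last neighbour `x i` of `t` before `x m` closes the induced cycle `x i, …, x (m + 1), t`.
  obtain ⟨i, him, hti, hlast⟩ : ∃ i ≤ m, G.Adj t (x i) ∧ ∀ j, i < j → j ≤ m → ¬ G.Adj t (x j) :=
    ⟨Nat.findGreatest (fun i => G.Adj t (x i)) m, Nat.findGreatest_le m,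
      Nat.findGreatest_spec (P := fun i => G.Adj t (x i)) m.zero_le h0,
      fun _ => Nat.findGreatest_is_greatest⟩
  have hne : i ≠ m := fun h => htm (h ▸ hti)
  refine hG.not_inducedCycle (n := m - i + 3) (by omega)
    (fun k => if k ≤ m + 1 - i then x (i + k) else t) fun a b hab hb => ?_
  by_cases hbm : b ≤ m + 1 - i
  · simp only [hab.le.trans hbm, hbm, if_true]
    obtain ⟨h, h'⟩ := hx (i + a) (i + b) (by omega) (by omega)
    exact ⟨h, h'.trans (by omega)⟩
  · have ham : a ≤ m + 1 - i := by omega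
    simp only [ham, hbm, if_true, if_false]
    refine ⟨(ht _ (by omega)).symm, ?_⟩
    rw [G.adj_comm]
    constructor
    · intro h
      by_contra ha
      exact hlast (i + a) (by omega) (by omega) h
    · intro ha
      obtain rfl | rfl : a = 0 ∨ a = m + 1 - i := by omega
      · exact hti
      · rwa [show i + (m + 1 - i) = m + 1 by omega]

theorem exists_adj_forall_adj (hG : IsChordal G) {C Q : Set V} (hC : (G.induce C).Connected)
    (hQ : G.IsClique Q) (hCQ : Disjoint C Q) {c s : V} (hc : c ∈ C) (hs : s ∈ Q)
    (hsC : ∃ d ∈ C, G.Adj s d) (hsc : ¬ G.Adj s c) :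
    ∃ y ∈ C, G.Adj s y ∧ ∀ t ∈ Q, G.Adj t c → G.Adj t y := by
  obtain ⟨d, hd, hsd⟩ := hsC
  have hsingle : (G.induce ({s} : Set V)).Preconnected := .of_subsingleton
  have hconn : (G.induce (insert s C)).Connected :=
    connected_induce_union hsingle hC.preconnected (Set.mem_singleton s) hd hsd
  obtain ⟨p, hp⟩ := hconn.exists_walk_length_eq_dist ⟨c, Set.mem_insert_of_mem s hc⟩
    ⟨s, Set.mem_insert s C⟩
  have hsne : s ≠ c := fun h => Set.disjoint_left.mp hCQ hc (h ▸ hs)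
  obtain ⟨m, hm⟩ : ∃ m, p.length = m + 1 :=
    Nat.exists_eq_succ_of_ne_zero fun h =>
      hsne (congrArg Subtype.val (Walk.eq_of_length_eq_zero h)).symm
  have hx : IsInducedPath G (fun i => (p.getVert i : V)) (m + 1) := fun i j hij hj =>
    (isInducedPath_getVert hp i j hij (hm ▸ hj)).imp_left Subtype.coe_injective.ne
  have hend : (p.getVert (m + 1) : V) = s := by rw [← hm, Walk.getVert_length]
  obtain ⟨hne, hadj⟩ := hx m (m + 1) m.lt_succ_self le_rfl
  simp only [hend, iff_true] at hne hadj
  refine ⟨p.getVert m, (p.getVert m).2.resolve_left hne, hadj.symm, fun t ht htc => ?_⟩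
  have hts : t ≠ s := fun h => hsc (h ▸ htc)
  refine hG.adj_of_isInducedPath hx (fun i _ h => ?_) (by simpa using htc) ?_
  · exact (h ▸ (p.getVert i).2 : t ∈ insert s C).elim hts fun h => Set.disjoint_left.mp hCQ h ht
  · rw [hend]
    exact hQ ht hs hts

theorem exists_adj_all [Finite V] (hG : IsChordal G) {C Q : Set V} (hC : (G.induce C).Connected)
    (hQ : G.IsClique Q) (hCQ : Disjoint C Q) :
    ∃ c ∈ C, ∀ s ∈ Q, (∃ d ∈ C, G.Adj s d) → G.Adj s c := by
  obtain ⟨c, hc, hmax⟩ := (Set.toFinite C).exists_maximalFor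
    (fun c => {s ∈ Q | G.Adj s c}) C (Set.nonempty_coe_sort.mp hC.nonempty)
  refine ⟨c, hc, fun s hs hsC => ?_⟩
  by_contra hsc
  obtain ⟨y, hy, hsy, hcy⟩ := hG.exists_adj_forall_adj hC hQ hCQ hc hs hsC hsc
  exact hsc (hmax hy (fun t ht => ⟨ht.1, hcy t ht.1 ht.2⟩) ⟨hs, hsy⟩).2

end IsChordal

end Chordal

section Glue

variable {W W' : Type u} {T : SimpleGraph W} {T' : SimpleGraph W'}

/-- `s` is the vertex set of a path of `T` from `x` to `y`; unlike `IsPathVertexSet` this keeps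
track of the ends, so that paths can be prolonged. -/
def PathBetween (T : SimpleGraph W) (x y : W) (s : Set W) : Prop :=
  ∃ p : T.Walk x y, p.IsPath ∧ s = {w | w ∈ p.support}

namespace PathBetween

variable {x y z : W} {s s' : Set W}

theorem isPathVertexSet (h : PathBetween T x y s) : IsPathVertexSet T s := ⟨x, y, h⟩

theorem singleton (T : SimpleGraph W) (x : W) : PathBetween T x x {x} :=
  ⟨Walk.nil, Walk.IsPath.nil, by simp⟩

theorem left_mem (h : PathBetween T x y s) : x ∈ s := by
  obtain ⟨p, -, rfl⟩ := h
  exact p.start_mem_support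

theorem right_mem (h : PathBetween T x y s) : y ∈ s := by
  obtain ⟨p, -, rfl⟩ := h
  exact p.end_mem_support

theorem symm (h : PathBetween T x y s) : PathBetween T y x s := by
  obtain ⟨p, hp, rfl⟩ := h
  exact ⟨p.reverse, hp.reverse, by simp⟩

theorem append (h : PathBetween T x y s) (h' : PathBetween T y z s')
    (hss : ∀ w ∈ s, w ∈ s' → w = y) : PathBetween T x z (s ∪ s') := by
  obtain ⟨p, hp, rfl⟩ := h
  obtain ⟨q, hq, rfl⟩ := h'
  exact ⟨p.append q, isPath_append hp hq hss, by ext; simp⟩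

theorem map (h : PathBetween T x y s) (f : T →g T') (hf : Function.Injective f) :
    PathBetween T' (f x) (f y) (f '' s) := by
  obtain ⟨p, hp, rfl⟩ := h
  exact ⟨p.map f, Walk.IsPath.map hf hp, by ext; simp⟩

end PathBetween

theorem not_isCycle_of_support_subset_range (hT : T.IsAcyclic) (f : T ↪g T') {x : W'}
    {p : T'.Walk x x} (hp : ∀ z ∈ p.support, z ∈ Set.range f) : ¬ p.IsCycle := fun hcycle =>
  f.isoInduceRange.isAcyclic_iff.mp hT (p.induce _ hp) <|
    Walk.IsCycle.of_map (f := (Embedding.induce _).toHom) <| by rwa [Walk.map_induce]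

theorem isAcyclic_sum (hT : T.IsAcyclic) (hT' : T'.IsAcyclic) : (T ⊕g T').IsAcyclic := by
  classical
  rintro (v | v) p
  · refine not_isCycle_of_support_subset_range hT Embedding.sumInl ?_
    rintro (z | z) hz
    · exact ⟨z, rfl⟩
    · exact absurd ⟨p.takeUntil _ hz⟩ (not_reachable_sum_inl_inr v z)
  · refine not_isCycle_of_support_subset_range hT' Embedding.sumInr ?_
    rintro (z | z) hz
    · exact absurd ⟨p.dropUntil _ hz⟩ (not_reachable_sum_inl_inr z v)
    · exact ⟨z, rfl⟩

/-- The disjoint union of `T` and `T'` together with an edge from `x` to `y`: this hangs the tree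
`T'`, with root `y`, at the node `x` of the tree `T`. -/
def glue (T : SimpleGraph W) (T' : SimpleGraph W') (x : W) (y : W') : SimpleGraph (W ⊕ W') :=
  (T ⊕g T') ⊔ edge (Sum.inl x) (Sum.inr y)

theorem isTree_glue (hT : T.IsTree) (hT' : T'.IsTree) (x : W) (y : W') :
    (glue T T' x y).IsTree :=
  ⟨hT.connected.sum_sup_edge hT'.connected,
    (isAcyclic_sum hT.isAcyclic hT'.isAcyclic).sup_edge_of_not_reachable
      (not_reachable_sum_inl_inr x y)⟩

namespace PathBetween

theorem glue_inl {a b : W} {s : Set W} (h : PathBetween T a b s) (x : W) (y : W') :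
    PathBetween (glue T T' x y) (Sum.inl a) (Sum.inl b) (Sum.inl '' s) :=
  h.map ((Hom.ofLE le_sup_left).comp Embedding.sumInl.toHom) Sum.inl_injective

theorem glue_inr {a b : W'} {s : Set W'} (h : PathBetween T' a b s) (x : W) (y : W') :
    PathBetween (glue T T' x y) (Sum.inr a) (Sum.inr b) (Sum.inr '' s) :=
  h.map ((Hom.ofLE le_sup_left).comp Embedding.sumInr.toHom) Sum.inr_injective

theorem glue {a x : W} {y b : W'} {s : Set W} {s' : Set W'}
    (h : PathBetween T a x s) (h' : PathBetween T' y b s') :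
    PathBetween (glue T T' x y) (Sum.inl a) (Sum.inr b) (Sum.inl '' s ∪ Sum.inr '' s') := by
  have hxy : (PathGraph.glue T T' x y).Adj (Sum.inl x) (Sum.inr y) := .inr (by simp [edge_adj])
  have hedge : PathBetween (PathGraph.glue T T' x y) (Sum.inl x) (Sum.inr y)
      {Sum.inl x, Sum.inr y} :=
    ⟨hxy.toWalk, hxy.isPath_toWalk, by ext; simp⟩
  have hpath := ((h.glue_inl x y).append hedge ?_).append (h'.glue_inr x y) ?_
  · convert hpath using 1
    have hx := h.right_mem
    have hy := h'.left_mem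
    grind
  · rintro _ ⟨z, -, rfl⟩ hz
    simpa using hz
  · rintro (w | w) hw hw'
    · simp at hw'
    · simpa using hw

end PathBetween

end Glue

section OwnNodes

variable {V W : Type u} {G : SimpleGraph V} {T : SimpleGraph W} {φ : V → Set W} {x y : W} {a : V}

/-- The paths `φ`, with the path of `a` prolonged to a new leaf. -/
def addLeaf (φ : V → Set W) (a v : V) : Set (W ⊕ PUnit.{u + 1}) :=
  Sum.inl '' φ v ∪ Sum.inr '' {_z | v = a}

@[simp]
theorem inl_mem_addLeaf {v : V} {z : W} : Sum.inl z ∈ addLeaf φ a v ↔ z ∈ φ v := by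
  simp [addLeaf]

@[simp]
theorem inr_mem_addLeaf {v : V} {z : PUnit} : Sum.inr z ∈ addLeaf φ a v ↔ v = a := by
  simp [addLeaf]

theorem IsPathRepresentation.addLeaf (h : IsPathRepresentation G T φ)
    (ha : PathBetween T x y (φ a)) :
    IsPathRepresentation G (glue T (⊥ : SimpleGraph PUnit) y PUnit.unit) (addLeaf φ a) where
  isTree := isTree_glue h.isTree .of_subsingleton _ _
  isPath v := by
    obtain rfl | hv := eq_or_ne v a
    · convert (ha.glue (PathBetween.singleton (⊥ : SimpleGraph PUnit) PUnit.unit)).isPathVertexSet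
      ext (z | z) <;> simp
    · obtain ⟨b, c, hbc⟩ := h.isPath v
      convert (PathBetween.glue_inl hbc y PUnit.unit).isPathVertexSet
      ext (z | z) <;> simp [hv]
  adj_iff v w hvw := by
    rw [h.adj_iff v w hvw]
    refine ⟨fun ⟨z, hz, hz'⟩ => ⟨Sum.inl z, by simpa using hz, by simpa using hz'⟩, ?_⟩
    rintro ⟨z | z, hz, hz'⟩
    · exact ⟨z, by simpa using hz, by simpa using hz'⟩
    · exact absurd ((inr_mem_addLeaf.mp hz).trans (inr_mem_addLeaf.mp hz').symm) hvw

theorem IsPathRepresentation.exists_own_nodes [Finite W] (h : IsPathRepresentation G T φ)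
    {A : Set V} (hA : A.Finite) :
    ∃ (W' : Type u) (_ : Finite W') (T' : SimpleGraph W') (φ' : V → Set W'),
      IsPathRepresentation G T' φ' ∧ ∀ a ∈ A, ∃ z ∈ φ' a, ∀ w, w ≠ a → z ∉ φ' w := by
  induction A, hA using Set.Finite.induction_on with
  | empty => exact ⟨W, inferInstance, T, φ, h, by simp⟩
  | @insert a A _ _ ih =>
    obtain ⟨W, _, T, φ, h, hA⟩ := ih
    obtain ⟨x, y, hxy⟩ := h.isPath a
    refine ⟨W ⊕ PUnit, inferInstance, _, _, h.addLeaf hxy, ?_⟩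
    rintro b (rfl | hb)
    · exact ⟨Sum.inr PUnit.unit, by simp, fun w hw => by simp [hw]⟩
    · obtain ⟨z, hz, hz'⟩ := hA b hb
      exact ⟨Sum.inl z, by simp [hz], fun w hw => by simp [hz' w hw]⟩

theorem IsPathRepresentation.isPathGraph [Finite V] [Finite W] (h : IsPathRepresentation G T φ) :
    IsPathGraph G := by
  obtain ⟨W', hW', T', φ', h', hown⟩ := h.exists_own_nodes Set.finite_univ
  refine ⟨W', hW', T', φ', h'.isTree, h'.isPath, fun v w hvw => ?_, h'.adj_iff⟩
  by_contra hne
  obtain ⟨z, hz, hz'⟩ := hown v (Set.mem_univ v)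
  exact hz' w (Ne.symm hne) (hvw ▸ hz)

end OwnNodes

section InnerCliques

variable {V : Type u} {G : SimpleGraph V} {Q K B : Set V} {γ γ' : SepPart G Q} {v w c : V}

theorem exists_maximal_isClique [Finite V] {S : Set V} (hS : G.IsClique S) :
    ∃ K, S ⊆ K ∧ Maximal G.IsClique K :=
  (Set.toFinite {K : Set V | G.IsClique K}).exists_le_maximal hS

theorem exists_adj_of_connected {C A : Set V} (hC : (G.induce C).Connected) (hv : v ∈ C)
    (hvA : v ∈ A) (hw : w ∈ C) (hwA : w ∉ A) :
    ∃ x ∈ C, x ∈ A ∧ ∃ y ∈ C, y ∉ A ∧ G.Adj x y := by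
  obtain ⟨p, hp⟩ := exists_walk_of_connected hC hv hw
  obtain ⟨e, he, hx, hy⟩ := p.exists_boundary_dart A hvA hwA
  exact ⟨_, hp _ (p.dart_fst_mem_support_of_mem_darts he), hx,
    _, hp _ (p.dart_snd_mem_support_of_mem_darts he), hy, e.adj⟩

namespace SepPart

/-- `B` is a maximal clique of `G` that contains a vertex of the component of `γ`. These cliques
are the bags of the nodes of a host tree that belong to `γ`. -/
def IsInnerClique (γ : SepPart G Q) (B : Set V) : Prop :=
  Maximal G.IsClique B ∧ (B ∩ γ.comp.supp).Nonempty

theorem IsInnerClique.subset_verts (hB : γ.IsInnerClique B) : B ⊆ γ.verts := by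
  obtain ⟨hB, c, hcB, hc⟩ := hB
  intro x hx
  obtain rfl | hne := eq_or_ne c x
  · exact .inl hc
  · exact mem_verts_of_adj hc (hB.1 hcB hx hne)

theorem IsInnerClique.relevant (hB : γ.IsInnerClique B) (h : (B ∩ Q).Nonempty) :
    γ.Relevant B := by
  refine ⟨⟨⟨hB.subset_verts, hB.1.1⟩, fun S hS => hB.1.2 hS.2⟩, h, ?_⟩
  rintro rfl
  obtain ⟨c, hc, hcγ⟩ := hB.2
  exact notMem_of_mem_supp hcγ hc

theorem IsInnerClique.neighborOf (hB : γ.IsInnerClique B) (hvB : v ∈ B) (hv : v ∈ Q) :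
    γ.NeighborOf v :=
  ⟨B, hB.relevant ⟨v, hvB, hv⟩, hvB⟩

theorem IsInnerClique.unique (hB : γ.IsInnerClique B) (hB' : γ'.IsInnerClique B) : γ = γ' := by
  obtain ⟨-, c, hcB, hc⟩ := hB
  obtain hcγ' | hcQ := hB'.subset_verts hcB
  · exact eq_of_mem_supp hc hcγ'
  · exact absurd hcQ (notMem_of_mem_supp hc)

theorem IsInnerClique.eq_of_mem (hB : γ.IsInnerClique B) (hv : v ∈ γ'.comp.supp) (hvB : v ∈ B) :
    γ = γ' :=
  hB.unique ⟨hB.1, v, hvB, hv⟩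

theorem neighborOf_of_adj [Finite V] (hv : v ∈ Q) (hc : c ∈ γ.comp.supp) (h : G.Adj v c) :
    γ.NeighborOf v := by
  obtain ⟨K, hsub, hK⟩ := exists_maximal_isClique (isClique_pair.mpr fun _ => h)
  exact IsInnerClique.neighborOf ⟨hK, c, hsub (by simp), hc⟩ (hsub (by simp)) hv

theorem IsInnerClique.mem_of_neighborOf (hB : γ'.IsInnerClique B) (hdom : γ.DominatedBy γ')
    (hv : v ∈ Q) (hγv : γ.NeighborOf v) (hvB : v ∈ B) (hw : w ∈ Q) (hγw : γ.NeighborOf w) :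
    w ∈ B := by
  obtain ⟨K, hK, hvK⟩ := hγv
  obtain ⟨L, hL, hwL⟩ := hγw
  obtain hsub | hdisj := hdom.2 B (hB.relevant ⟨v, hvB, hv⟩)
  · exact (hsub L hL ⟨hwL, hw⟩).1
  · exact absurd ⟨v, ⟨hvK, hvB⟩, hv⟩ (Set.not_nonempty_iff_eq_empty.mpr (hdisj K hK))

end SepPart

theorem IsStrongColoring.le_or_le {α : Type*} {f : Gam G Q → α} (hf : IsStrongColoring f)
    (hatt : γ.Attached γ') (hcol : f γ.cls = f γ'.cls) : γ ≤ γ' ∨ γ' ≤ γ := by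
  by_contra! hne
  exact hf.ne_of_antipodal γ.cls γ'.cls
    ⟨⟨γ, γ', rfl, rfl, hatt⟩, mt SepPart.cls_le_cls.mp hne.1, mt SepPart.cls_le_cls.mp hne.2⟩ hcol

theorem IsStrongColoring.two_colors_sepPart {α : Type*} {f : Gam G Q → α}
    (hf : IsStrongColoring f) (hv : v ∈ Q) :
    ∃ a b, ∀ γ : SepPart G Q, γ.NeighborOf v → f γ.cls = a ∨ f γ.cls = b := by
  obtain ⟨a, b, hab⟩ := hf.two_colors v hv
  exact ⟨a, b, fun γ hγ => hab _ ((SepPart.neighborOf_cls hv).mpr hγ)⟩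

end InnerCliques

section CliquePathTrees

variable {V : Type u} {G : SimpleGraph V} {Q U U' : Set V}

/-- A clique path tree of `G`, restricted to the vertices of `U`: a tree whose nodes carry maximal
cliques of `G` such that the nodes of each vertex of `U` form a path and each edge of `G` at a
vertex of `U` lies in the clique of some node. -/
structure CliquePathTree (G : SimpleGraph V) (U : Set V) : Type (u + 1) where
  W : Type u
  finite : Finite W
  T : SimpleGraph W
  isTree : T.IsTree
  bag : W → Set V
  maximal_bag : ∀ z, Maximal G.IsClique (bag z)
  path : ∀ v ∈ U, IsPathVertexSet T {z | v ∈ bag z}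
  cover : ∀ v ∈ U, ∀ w, G.Adj v w → ∃ z, v ∈ bag z ∧ w ∈ bag z

attribute [instance] CliquePathTree.finite

namespace CliquePathTree

/-- The nodes whose cliques contain `v`. -/
def nodes (R : CliquePathTree G U) (v : V) : Set R.W := {z | v ∈ R.bag z}

theorem isPathRepresentation (R : CliquePathTree G Set.univ) :
    IsPathRepresentation G R.T R.nodes where
  isTree := R.isTree
  isPath v := R.path v (Set.mem_univ v)
  adj_iff v w hvw :=
    ⟨R.cover v (Set.mem_univ v) w, fun ⟨z, hv, hw⟩ => (R.maximal_bag z).1 hv hw hvw⟩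

/-- A clique path tree with a node for `Q` serves further vertices of `Q` as soon as their nodes
form paths. -/
def extend (R : CliquePathTree G U) {c : R.W} (hc : R.bag c = Q)
    (hpath : ∀ v ∈ Q, IsPathVertexSet R.T (R.nodes v)) (hU' : U' ⊆ Q ∪ U)
    (hadj : ∀ v ∈ U', ∀ w, G.Adj v w → w ∈ Q ∪ U) : CliquePathTree G U' where
  __ := R
  path v hv := (hU' hv).elim (hpath v) (R.path v)
  cover v hv w hvw := by
    obtain hvQ | hvU := hU' hv
    · obtain hwQ | hwU := hadj v hv w hvw
      · exact ⟨c, hc ▸ hvQ, hc ▸ hwQ⟩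
      · obtain ⟨z, hz⟩ := R.cover w hwU v hvw.symm
        exact ⟨z, hz.symm⟩
    · exact R.cover v hvU w hvw

theorem setOf_mem_sumElim (R : CliquePathTree G U) (P : CliquePathTree G U') (v : V) :
    {z | v ∈ Sum.elim R.bag P.bag z} = Sum.inl '' R.nodes v ∪ Sum.inr '' P.nodes v := by
  ext (z | z) <;> simp [nodes]

/-- The tree `P` hung with its node `y` at the node `x` of `R`. -/
def join (R : CliquePathTree G U) (P : CliquePathTree G U') (x : R.W) (y : P.W)
    (hP : ∀ v ∈ U, P.nodes v = ∅) (hR : ∀ v ∈ U', R.nodes v = ∅) :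
    CliquePathTree G (U' ∪ U) where
  W := R.W ⊕ P.W
  finite := inferInstance
  T := glue R.T P.T x y
  isTree := isTree_glue R.isTree P.isTree x y
  bag := Sum.elim R.bag P.bag
  maximal_bag := Sum.rec R.maximal_bag P.maximal_bag
  path v hv := by
    rw [setOf_mem_sumElim]
    obtain hvP | hvR := hv
    · obtain ⟨a, b, h⟩ := P.path v hvP
      rw [hR v hvP, Set.image_empty, Set.empty_union]
      exact (PathBetween.glue_inr h x y).isPathVertexSet
    · obtain ⟨a, b, h⟩ := R.path v hvR
      rw [hP v hvR, Set.image_empty, Set.union_empty]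
      exact (PathBetween.glue_inl h x y).isPathVertexSet
  cover v hv w hvw := by
    obtain hvP | hvR := hv
    · obtain ⟨z, hz⟩ := P.cover v hvP w hvw
      exact ⟨Sum.inr z, hz⟩
    · obtain ⟨z, hz⟩ := R.cover v hvR w hvw
      exact ⟨Sum.inl z, hz⟩

end CliquePathTree

/-- A clique path tree for the component of `γ` whose cliques are inner cliques of `γ`, and with a
root at which the paths of the vertices of `Q` start. -/
structure RootedPathTree (γ : SepPart G Q) extends CliquePathTree G γ.comp.supp where
  isInnerClique : ∀ z, γ.IsInnerClique (bag z)
  root : W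
  rooted : ∀ v ∈ Q, γ.NeighborOf v → ∃ e, PathBetween T root e (toCliquePathTree.nodes v)

namespace CliquePathTree

variable {α : Type*}

/-- The node `c` together with the nodes of `v` that carry an inner clique of a part with the
color `a`. -/
def branchNodes (R : CliquePathTree G U) (f : Gam G Q → α) (c : R.W) (v : V) (a : α) : Set R.W :=
  insert c {z | v ∈ R.bag z ∧ ∃ γ : SepPart G Q, f γ.cls = a ∧ γ.IsInnerClique (R.bag z)}

end CliquePathTree

/-- The vertices of the components of the parts in `J`. -/
def compUnion (J : Set (SepPart G Q)) : Set V := ⋃ γ ∈ J, γ.comp.supp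

theorem mem_compUnion {J : Set (SepPart G Q)} {v : V} :
    v ∈ compUnion J ↔ ∃ γ ∈ J, v ∈ γ.comp.supp := by
  simp only [compUnion, Set.mem_iUnion, exists_prop]

/-- A clique path tree for the parts in `J`, with `Q` in the center: for every vertex of `Q` and
every color, the inner cliques of the parts of this color form a path that starts at the center. -/
structure ColoredPathTree {α : Type*} (f : Gam G Q → α) (J : Set (SepPart G Q)) extends
    CliquePathTree G (compUnion J) where
  center : W
  bag_center : bag center = Q
  eq_center_or : ∀ z, z = center ∨ ∃ γ ∈ J, γ.IsInnerClique (bag z)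
  branch : ∀ v ∈ Q, ∀ a, ∃ e,
    PathBetween T center e (toCliquePathTree.branchNodes f center v a)

end CliquePathTrees

section Gluing

variable {V : Type u} {G : SimpleGraph V} {Q : Set V} {α : Type*} {f : Gam G Q → α}
  {J : Set (SepPart G Q)} {γ : SepPart G Q} {v : V} {a b : α}

namespace RootedPathTree

theorem nodes_eq_empty (P : RootedPathTree γ) (hv : v ∉ γ.verts) : P.nodes v = ∅ :=
  Set.eq_empty_iff_forall_notMem.mpr fun z hz => hv ((P.isInnerClique z).subset_verts hz)

theorem setOf_isInnerClique (P : RootedPathTree γ) (f : Gam G Q → α) (v : V) (a : α) :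
    {z | v ∈ P.bag z ∧ ∃ γ' : SepPart G Q, f γ'.cls = a ∧ γ'.IsInnerClique (P.bag z)} =
      {z ∈ P.nodes v | f γ.cls = a} := by
  ext z
  refine and_congr_right fun _ => ⟨?_, fun h => ⟨γ, h, P.isInnerClique z⟩⟩
  rintro ⟨γ', rfl, h⟩
  rw [h.unique (P.isInnerClique z)]

end RootedPathTree

theorem CliquePathTree.branchNodes_join {U U' : Set V} (R : CliquePathTree G U)
    (P : CliquePathTree G U') (x : R.W) (y : P.W) (hP : ∀ v ∈ U, P.nodes v = ∅)
    (hR : ∀ v ∈ U', R.nodes v = ∅) (f : Gam G Q → α) (c : R.W) (v : V) (a : α) :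
    (R.join P x y hP hR).branchNodes f (Sum.inl c) v a = Sum.inl '' R.branchNodes f c v a ∪
      Sum.inr '' {z | v ∈ P.bag z ∧
        ∃ γ' : SepPart G Q, f γ'.cls = a ∧ γ'.IsInnerClique (P.bag z)} := by
  change (insert (Sum.inl c) {z | v ∈ Sum.elim R.bag P.bag z ∧ ∃ γ : SepPart G Q,
    f γ.cls = a ∧ γ.IsInnerClique (Sum.elim R.bag P.bag z)} : Set (R.W ⊕ P.W)) = _
  ext (z | z) <;> simp [branchNodes]

namespace ColoredPathTree

/-- The tree whose only node carries `Q`. -/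
def single (f : Gam G Q → α) (hQ : Maximal G.IsClique Q) : ColoredPathTree f ∅ where
  W := PUnit
  finite := inferInstance
  T := ⊥
  isTree := .of_subsingleton
  bag := fun _ => Q
  maximal_bag := fun _ => hQ
  path := by simp [compUnion]
  cover := by simp [compUnion]
  center := PUnit.unit
  bag_center := rfl
  eq_center_or := fun _ => .inl rfl
  branch := fun v _ a => ⟨PUnit.unit, by
    convert PathBetween.singleton _ _
    ext z
    simp [CliquePathTree.branchNodes]⟩

theorem nodes_eq_empty (R : ColoredPathTree f J) (hγ : γ ∉ J) (hv : v ∈ γ.comp.supp) :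
    R.nodes v = ∅ := by
  refine Set.eq_empty_iff_forall_notMem.mpr fun z (hz : v ∈ R.bag z) => ?_
  obtain rfl | ⟨γ', hγ', h⟩ := R.eq_center_or z
  · exact SepPart.notMem_of_mem_supp hv (R.bag_center ▸ hz)
  · exact hγ (h.eq_of_mem hv hz ▸ hγ')

/-- The tree of a further part, hung at the node `x`. -/
def insertPart (R : ColoredPathTree f J) (hγ : γ ∉ J) (P : RootedPathTree γ) (x : R.W)
    (hx : ∀ v ∈ Q, γ.NeighborOf v →
      PathBetween R.T R.center x (R.branchNodes f R.center v (f γ.cls))) :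
    ColoredPathTree f (insert γ J) :=
  have hP : ∀ v ∈ compUnion J, P.nodes v = ∅ := fun v hv => by
    obtain ⟨γ', hγ', hv⟩ := mem_compUnion.mp hv
    refine P.nodes_eq_empty fun h => h.elim (fun h => hγ ?_) (SepPart.notMem_of_mem_supp hv)
    exact SepPart.eq_of_mem_supp h hv ▸ hγ'
  let join := R.join P.toCliquePathTree x P.root hP fun _ => R.nodes_eq_empty hγ
  have hJ : compUnion (insert γ J) = γ.comp.supp ∪ compUnion J := Set.biUnion_insert _ _ _
  { join with
    path := by rw [hJ]; exact join.path
    cover := by rw [hJ]; exact join.cover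
    center := Sum.inl R.center
    bag_center := R.bag_center
    eq_center_or := Sum.rec
      (fun z => (R.eq_center_or z).imp (congrArg Sum.inl)
        fun ⟨γ', h, h'⟩ => ⟨γ', Set.mem_insert_of_mem _ h, h'⟩)
      fun z => .inr ⟨γ, Set.mem_insert _ _, P.isInnerClique z⟩
    branch := fun v hv a => by
      change ∃ e, PathBetween (glue R.T P.T x P.root) _ e (join.branchNodes f _ v a)
      rw [CliquePathTree.branchNodes_join, P.setOf_isInnerClique]
      by_cases h : γ.NeighborOf v ∧ f γ.cls = a
      · obtain ⟨hγv, rfl⟩ := h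
        obtain ⟨e, he⟩ := P.rooted v hv hγv
        exact ⟨Sum.inr e, by simpa using (hx v hv hγv).glue he⟩
      · have hempty : {z ∈ P.nodes v | f γ.cls = a} = ∅ :=
          Set.eq_empty_iff_forall_notMem.mpr fun z hz =>
            h ⟨(P.isInnerClique z).neighborOf hz.1 hv, hz.2⟩
        obtain ⟨e, he⟩ := R.branch v hv a
        rw [hempty, Set.image_empty, Set.union_empty]
        exact ⟨Sum.inl e, he.glue_inl x P.root⟩ }

theorem exists_common_end (R : ColoredPathTree f J) (hf : IsStrongColoring f) (hγ : γ ∉ J)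
    (hle : ∀ γ' ∈ J, γ' ≤ γ → γ ≤ γ') :
    ∃ e, ∀ v ∈ Q, γ.NeighborOf v →
      PathBetween R.T R.center e (R.branchNodes f R.center v (f γ.cls)) := by
  have hmem : ∀ v ∈ Q, γ.NeighborOf v → ∀ w ∈ Q, γ.NeighborOf w →
      R.branchNodes f R.center v (f γ.cls) ⊆ R.branchNodes f R.center w (f γ.cls) := by
    rintro v hv hγv w hw hγw z (rfl | ⟨hvz, γ', hcol, hinner⟩)
    · exact Set.mem_insert _ _
    obtain rfl | ⟨γ'', hγ'', h⟩ := R.eq_center_or z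
    · exact Set.mem_insert _ _
    obtain rfl := h.unique hinner
    have hatt : γ.Attached γ'' :=
      SepPart.attached_iff.mpr ⟨v, hv, hγv, hinner.neighborOf hvz hv⟩
    have hdom : γ ≤ γ'' := (hf.le_or_le hatt hcol.symm).elim id (hle γ'' hγ'')
    refine Set.mem_insert_of_mem _ ⟨?_, γ'', hcol, hinner⟩
    exact hinner.mem_of_neighborOf (hdom.resolve_left fun h => hγ (h ▸ hγ'')) hv hγv hvz hw hγw
  by_cases hne : ∃ v ∈ Q, γ.NeighborOf v
  · obtain ⟨v, hv, hγv⟩ := hne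
    obtain ⟨e, he⟩ := R.branch v hv (f γ.cls)
    refine ⟨e, fun w hw hγw => ?_⟩
    rwa [(hmem w hw hγw v hv hγv).antisymm (hmem v hv hγv w hw hγw)]
  · exact ⟨R.center, fun v hv hγv => absurd ⟨v, hv, hγv⟩ hne⟩

theorem nonempty_of_rooted [Finite V] (hQ : Maximal G.IsClique Q) (hf : IsStrongColoring f)
    (hJ : ∀ γ ∈ J, Nonempty (RootedPathTree γ)) : Nonempty (ColoredPathTree f J) := by
  induction J using WellFoundedLT.induction with
  | _ J ih =>
    obtain rfl | hne := J.eq_empty_or_nonempty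
    · exact ⟨single f hQ⟩
    -- Parts are hung from the top of the dominance order downwards.
    obtain ⟨γ, hγ⟩ := J.toFinite.exists_minimal hne
    obtain ⟨R⟩ := ih (J \ {γ}) (Set.sdiff_singleton_ssubset.mpr hγ.1) fun γ' h => hJ γ' h.1
    obtain ⟨P⟩ := hJ γ hγ.1
    obtain ⟨x, hx⟩ := R.exists_common_end hf (by simp) fun γ' h => hγ.2 h.1
    have hinsert : insert γ (J \ {γ}) = J := by
      rw [Set.insert_sdiff_singleton, Set.insert_eq_of_mem hγ.1]
    exact hinsert ▸ ⟨R.insertPart (by simp) P x hx⟩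

theorem nodes_eq_union (R : ColoredPathTree f J) (hv : v ∈ Q)
    (hab : ∀ γ : SepPart G Q, γ.NeighborOf v → f γ.cls = a ∨ f γ.cls = b) :
    R.nodes v = R.branchNodes f R.center v a ∪ R.branchNodes f R.center v b := by
  have hcenter : v ∈ R.bag R.center := R.bag_center.symm ▸ hv
  refine Set.Subset.antisymm (fun z hz => ?_) (Set.union_subset ?_ ?_)
  · obtain rfl | ⟨γ, -, h⟩ := R.eq_center_or z
    · exact .inl (Set.mem_insert _ _)
    · exact (hab γ (h.neighborOf hz hv)).imp (fun ha => Set.mem_insert_of_mem _ ⟨hz, γ, ha, h⟩)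
        fun hb => Set.mem_insert_of_mem _ ⟨hz, γ, hb, h⟩
  all_goals exact Set.insert_subset hcenter fun z hz => hz.1

theorem eq_center_of_mem_branchNodes (R : ColoredPathTree f J) (hab : a ≠ b) {z : R.W}
    (ha : z ∈ R.branchNodes f R.center v a) (hb : z ∈ R.branchNodes f R.center v b) :
    z = R.center := by
  obtain h | ⟨-, γ, rfl, hγ⟩ := ha
  · exact h
  obtain h | ⟨-, γ', rfl, hγ'⟩ := hb
  · exact h
  · exact absurd (congrArg (fun γ => f γ.cls) (hγ.unique hγ')) hab

theorem exists_pathBetween_nodes (R : ColoredPathTree f J) (hv : v ∈ Q)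
    (hab : ∀ γ : SepPart G Q, γ.NeighborOf v → f γ.cls = a ∨ f γ.cls = b) {e : R.W}
    (he : PathBetween R.T R.center e (R.branchNodes f R.center v a)) :
    ∃ e', PathBetween R.T e e' (R.nodes v) := by
  rw [R.nodes_eq_union hv hab]
  obtain rfl | hne := eq_or_ne a b
  · exact ⟨R.center, by simpa using he.symm⟩
  · obtain ⟨e', he'⟩ := R.branch v hv b
    exact ⟨e', he.symm.append he' fun z => R.eq_center_of_mem_branchNodes hne⟩

theorem isPathVertexSet_nodes (R : ColoredPathTree f J) (hf : IsStrongColoring f) (hv : v ∈ Q) :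
    IsPathVertexSet R.T (R.nodes v) := by
  obtain ⟨a, b, hab⟩ := hf.two_colors_sepPart hv
  obtain ⟨e, he⟩ := R.branch v hv a
  obtain ⟨e', he'⟩ := R.exists_pathBetween_nodes hv hab he
  exact he'.isPathVertexSet

theorem exists_pathBetween_nodes_of_neighborOf (R : ColoredPathTree f J)
    (hf : IsStrongColoring f) (hv : v ∈ Q) (hγ : γ.NeighborOf v) {e : R.W}
    (he : PathBetween R.T R.center e (R.branchNodes f R.center v (f γ.cls))) :
    ∃ e', PathBetween R.T e e' (R.nodes v) := by
  obtain ⟨a, b, hab⟩ := hf.two_colors_sepPart hv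
  obtain h | h := hab γ hγ
  · exact R.exists_pathBetween_nodes hv hab (h ▸ he)
  · exact R.exists_pathBetween_nodes hv (fun γ hγ => (hab γ hγ).symm) (h ▸ he)

end ColoredPathTree

end Gluing

section Refinement

variable {V : Type u} {G : SimpleGraph V} {Q L : Set V} {γ : SepPart G Q} {δ : SepPart G L}
  {v w : V}

namespace SepPart

/-- `L` contains all the vertices of `Q` that are adjacent to the component of `γ`. -/
def IsSeparatedBy (γ : SepPart G Q) (L : Set V) : Prop :=
  ∀ v ∈ Q, γ.NeighborOf v → v ∈ L

theorem exists_isInnerClique_isSeparatedBy [Finite V] (hG : IsChordal G) (hQ : G.IsClique Q)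
    (γ : SepPart G Q) : ∃ L, γ.IsInnerClique L ∧ γ.IsSeparatedBy L := by
  obtain ⟨d, hd, hadj⟩ := hG.exists_adj_all γ.connected_supp hQ
    (Set.disjoint_left.mpr fun _ => notMem_of_mem_supp)
  obtain ⟨L, hsub, hL⟩ := exists_maximal_isClique (G := G)
    (S := insert d {v ∈ Q | γ.NeighborOf v}) <|
      (hQ.subset fun v hv => hv.1).insert fun v hv _ =>
        (hadj v hv.1 (hv.2.exists_adj hQ hv.1)).symm
  exact ⟨L, ⟨hL, d, hsub (Set.mem_insert _ _), hd⟩,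
    fun v hv hγv => hsub (Set.mem_insert_of_mem _ ⟨hv, hγv⟩)⟩

variable [Finite V]

theorem IsSeparatedBy.mem_or_mem_supp_of_adj (h : γ.IsSeparatedBy L) (hv : v ∈ γ.comp.supp)
    (hvw : G.Adj v w) : w ∈ L ∨ w ∈ γ.comp.supp :=
  (mem_verts_of_adj hv hvw).symm.imp_left fun hw => h w hw (neighborOf_of_adj hw hv hvw.symm)

theorem IsSeparatedBy.supp_subset (h : γ.IsSeparatedBy L) (hvδ : v ∈ δ.comp.supp)
    (hvγ : v ∈ γ.comp.supp) : δ.comp.supp ⊆ γ.comp.supp := by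
  intro w hw
  by_contra hwγ
  obtain ⟨x, -, hxγ, y, hyδ, hyγ, hxy⟩ :=
    exists_adj_of_connected δ.connected_supp hvδ hvγ hw hwγ
  exact (h.mem_or_mem_supp_of_adj hxγ hxy).elim (notMem_of_mem_supp hyδ) hyγ

theorem IsSeparatedBy.mem_or_mem_compUnion (h : γ.IsSeparatedBy L) (hv : v ∈ L ∨ v ∈ γ.comp.supp) :
    v ∈ L ∪ compUnion {δ : SepPart G L | δ.comp.supp ⊆ γ.comp.supp} := by
  by_cases hvL : v ∈ L
  · exact .inl hvL
  · obtain ⟨δ, hδ⟩ := exists_mem_supp hvL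
    exact .inr (mem_compUnion.mpr ⟨δ, h.supp_subset hδ (hv.resolve_left hvL), hδ⟩)

theorem IsInnerClique.exists_outer_part (hQ : Maximal G.IsClique Q) (hL : γ.IsInnerClique L)
    (h : γ.IsSeparatedBy L) : ∃ δ₀ : SepPart G L,
      Disjoint δ₀.comp.supp γ.comp.supp ∧ ∀ v ∈ Q, γ.NeighborOf v → δ₀.NeighborOf v := by
  obtain ⟨hLmax, d, hdL, hd⟩ := hL
  obtain ⟨k, hkQ, hkL⟩ : ∃ k ∈ Q, k ∉ L := by
    by_contra! hQL
    exact notMem_of_mem_supp hd (hQ.2 hLmax.1 hQL hdL)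
  obtain ⟨δ₀, hk⟩ := exists_mem_supp hkL
  refine ⟨δ₀, Set.disjoint_left.mpr fun v hv hvγ =>
    notMem_of_mem_supp (h.supp_subset hv hvγ hk) hkQ, fun v hv hγv => ?_⟩
  have hvL := h v hv hγv
  exact neighborOf_of_adj hvL hk (hQ.1 hv hkQ fun hvk => hkL (hvk ▸ hvL))

theorem IsInnerClique.not_le_of_disjoint (hL : γ.IsInnerClique L) (h : γ.IsSeparatedBy L)
    (hδ : δ.comp.supp ⊆ γ.comp.supp) {δ₀ : SepPart G L}
    (hδ₀ : Disjoint δ₀.comp.supp γ.comp.supp) : ¬ δ ≤ δ₀ := by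
  obtain ⟨hLmax, d, hdL, hd⟩ := hL
  obtain ⟨⟨c, hc⟩⟩ := δ.connected_supp.nonempty
  intro hle
  obtain ⟨x, -, hxδ, y, hyγ, hyδ, hxy⟩ :=
    exists_adj_of_connected γ.connected_supp (hδ hc) hc hd fun h => notMem_of_mem_supp h hdL
  have hyL : y ∈ L := (mem_verts_of_adj hxδ hxy).resolve_left hyδ
  have hδ₀y : δ₀.NeighborOf y := (neighborOf_of_adj hyL hxδ hxy.symm).mono hle hyL
  obtain ⟨z, hz, hyz⟩ := hδ₀y.exists_adj hLmax.1 hyL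
  exact (h.mem_or_mem_supp_of_adj hyγ hyz).elim (notMem_of_mem_supp hz)
    (Set.disjoint_left.mp hδ₀ hz)

end SepPart

/-- Every maximal clique has a strong coloring, with an arbitrary set of colors. -/
def StronglyColorable (G : SimpleGraph V) : Prop :=
  ∀ Q, Maximal G.IsClique Q → ∃ (α : Type) (f : Gam G Q → α), IsStrongColoring f

variable [Finite V]

theorem nonempty_rootedPathTree (hG : IsChordal G) (hs : StronglyColorable G)
    (hQ : Maximal G.IsClique Q) (γ : SepPart G Q) : Nonempty (RootedPathTree γ) := by
  induction hU : γ.comp.supp using WellFoundedLT.induction generalizing Q γ with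
  | _ U ih =>
    subst hU
    obtain ⟨L, hL, hsep⟩ := γ.exists_isInnerClique_isSeparatedBy hG hQ.1
    obtain ⟨δ₀, hdisj, hδ₀⟩ := hL.exists_outer_part hQ hsep
    obtain ⟨α, f, hf⟩ := hs L hL.1
    set J := {δ : SepPart G L | δ.comp.supp ⊆ γ.comp.supp}
    obtain ⟨d, hdL, hd⟩ := hL.2
    obtain ⟨R⟩ := ColoredPathTree.nonempty_of_rooted hL.1 hf (J := J) fun δ hδ =>
      ih _ ⟨hδ, fun hle => SepPart.notMem_of_mem_supp (hle hd) hdL⟩ hL.1 δ rfl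
    have hnot_le : ∀ δ ∈ J, ¬ δ ≤ δ₀ := fun δ hδ => hL.not_le_of_disjoint hsep hδ hdisj
    obtain ⟨x, hx⟩ := R.exists_common_end hf (fun h => hnot_le δ₀ h le_rfl)
      fun δ hδ hle => absurd hle (hnot_le δ hδ)
    refine ⟨{
      R.extend R.bag_center (fun v => R.isPathVertexSet_nodes hf)
        (fun v hv => hsep.mem_or_mem_compUnion (.inr hv))
        (fun v hv w hvw => hsep.mem_or_mem_compUnion (hsep.mem_or_mem_supp_of_adj hv hvw)) with
      isInnerClique := fun z => ?_
      root := x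
      rooted := fun v hv hγv => ?_ }⟩
    · obtain rfl | ⟨δ, hδ, hinner⟩ := R.eq_center_or z
      · exact R.bag_center.symm ▸ hL
      · exact ⟨hinner.1, hinner.2.mono (Set.inter_subset_inter_right _ hδ)⟩
    · have hvL := hsep v hv hγv
      have hδ₀v := hδ₀ v hv hγv
      exact R.exists_pathBetween_nodes_of_neighborOf hf hvL hδ₀v (hx v hvL hδ₀v)

theorem IsChordal.isPathGraph (hG : IsChordal G) (hs : StronglyColorable G) : IsPathGraph G := by
  obtain ⟨Q, -, hQ⟩ := exists_maximal_isClique (G := G) isClique_empty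
  obtain ⟨α, f, hf⟩ := hs Q hQ
  obtain ⟨R⟩ := ColoredPathTree.nonempty_of_rooted (J := Set.univ) hQ hf fun γ _ =>
    nonempty_rootedPathTree hG hs hQ γ
  have hcover : ∀ v, v ∈ Q ∪ compUnion (Set.univ : Set (SepPart G Q)) := fun v =>
    (em (v ∈ Q)).imp_right fun hv =>
      have ⟨γ, hγ⟩ := SepPart.exists_mem_supp hv
      mem_compUnion.mpr ⟨γ, Set.mem_univ γ, hγ⟩
  exact (R.extend (U' := Set.univ) R.bag_center (fun v => R.isPathVertexSet_nodes hf)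
    (fun v _ => hcover v) fun _ _ w _ => hcover w).isPathRepresentation.isPathGraph

end Refinement

theorem IsStrongColoring.of_subsingleton {V : Type u} {G : SimpleGraph V} {Q : Set V}
    [Subsingleton (G.ComponentCompl Q)] : IsStrongColoring fun _ : Gam G Q => () where
  ne_of_antipodal c c' h := by
    induction c using Quotient.inductionOn with | _ γ
    induction c' using Quotient.inductionOn with | _ γ'
    exact absurd (SepPart.ext (Subsingleton.elim γ.comp γ'.comp) ▸ le_rfl) h.2.1
  two_colors _ _ := ⟨(), (), fun _ _ => .inl rfl⟩

end PathGraph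

theorem theorem3p6 {V : Type u} [Finite V] (G : SimpleGraph V) (hG : PathGraph.IsChordal G)
    (o : ∀ Q : Set V, PathGraph.UpperOrdering G Q) :
    PathGraph.IsPathGraph G ↔
      ∀ Q : Set V, PathGraph.IsCliqueSeparator G Q →
        (¬ ∃ a ∈ PathGraph.Upper G Q, ∃ b ∈ PathGraph.Upper G Q, ∃ c ∈ PathGraph.Upper G Q,
          PathGraph.IsFullAntipodalTriple a b c) ∧
        ∃ f : PathGraph.Gam G Q → Fin (PathGraph.ell G Q + 1),
          PathGraph.IsWeakColoring (o Q) f := by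
  constructor
  · intro h Q hQ
    obtain ⟨α, f, hf⟩ := h.exists_isStrongColoring hQ.1
    exact ⟨fun ⟨a, _, b, _, c, _, habc⟩ => hf.not_isFullAntipodalTriple a b c habc,
      _, hf.isWeakColoring_weakColor (o Q)⟩
  · intro h
    refine hG.isPathGraph fun Q hQ => ?_
    obtain hc | hc := subsingleton_or_nontrivial (G.ComponentCompl Q)
    · exact ⟨Unit, _, .of_subsingleton⟩
    · obtain ⟨htriple, f, hf⟩ := h Q ⟨hQ, hc⟩
      exact ⟨_, f, hf.isStrongColoring htriple⟩
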